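/- **Setting.** Let $M$ be a Frobenius manifold of rank $n\ge 1$ and conformal dimension $d\neq 1$: a holomorphic prepotential $F$ on a domain $B\subset\mathbb{C}^n$ with flat coordinates $t^1,\dots,t^n$, a constant inner product $\eta$, product $\partial_\alpha\cdot\partial_\beta=\sum_{\kappa,\gamma}(\partial_\alpha\partial_\beta\partial_\kappa F)\,\eta^{\kappa\gamma}\partial_\gamma$, which is commutative, associative, $\eta$-invariant and has unit $\partial_{t^1}$, and an Euler field $E=\sum_\alpha((1-q_\alpha)t^\alpha+r_\alpha)\partial_\alpha$ ($q_1=0$, and $r_\alpha\ne0$ only if $q_\alpha=1$) such that $E.F-(3-d)F$ is a polynomial of degree at most $2$. Let $B_0\subset B$ be a connected open set of semisimple points with canonical coordinates $u_1,\dots,u_n$: the $\partial_{u_i}$ are the idempotents of the product and $E=\sum_i u_i\partial_{u_i}$. Put $\Delta_i^{-1}=\eta(\partial_{u_i},\partial_{u_i})$, choose holomorphic branches of $\Delta_i^{-1/2}$, and let $\Psi$, $\Psi_{i\alpha}=\Delta_i^{-1/2}\,\partial u_i/\partial t^\alpha$, be the transition matrix from the flat frame to the frame $\Delta_i^{1/2}\partial_{u_i}$.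 Let $U=\mathrm{diag}(u_i)$, $\mu=\mathrm{diag}(q_\alpha-d/2)$, $V=\Psi\mu\Psi^{-1}$. Let $R(z)=I+R_1z+R_2z^2+\cdots$ be the formal power series of matrix functions on $B_0$ for which $\Psi^{-1}R(z^{-1})e^{-zU}$ is a formal fundamental matrix of flat sections at $z=\infty$ of the connection $\tilde\nabla_{\partial'}\partial''=\nabla^\eta_{\partial'}\partial''+z\,\partial'\cdot\partial''$, $\tilde\nabla_{\partial_z}\partial'=\partial_z\partial'+E\cdot\partial'-\frac1z\mu\,\partial'$. **Superpotential.** Choose parallel cuts $L_i$ in the $\lambda$-plane from $u_i$ to infinity with $u_j\notin L_i$ for $i\ne j$, and branches of $\sqrt{u_i-\lambda}$ off the cuts, depending continuously on $(\lambda,t)$. Let $\phi^{(1)},\dots,\phi^{(n)}$ be the solutions off the cuts of $$d\phi=-(U-\lambda)^{-1}d(U-\lambda)\left(\tfrac12+V\right)\phi+d\Psi\,\Psi^{-1}\phi,\qquad d=d_\lambda+d_u,$$ such that $\phi^{(j)}$ changes sign under the monodromy around $u_j$, and, as $\lambda\to u_j$, $\phi^{(j)}_j=\frac1{\sqrt{u_j-\lambda}}+O(\sqrt{u_j-\lambda})$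 and $\phi^{(j)}_a=O(\sqrt{u_j-\lambda})$ for $a\ne j$. Let $G^{ij}=(\phi^{(i)})^T(U-\lambda)\phi^{(j)}$, a constant matrix, let $\gamma\in\mathbb{C}^n$ satisfy $\sum_jG^{ij}\gamma_j=1$ for all $i$ (if $G$ is nondegenerate with inverse $(G_{ij})$, this means $\gamma_j=\sum_iG_{ij}$), and put $$\phi=\sum_j\gamma_j\phi^{(j)},\qquad p(\lambda,t)=\frac{\sqrt2}{1-d}\,\phi^T(U-\lambda)\Psi\mathbb 1,$$ where $\mathbb 1$ is the unit vector. Fix $t\in B_0$. Let $\mathcal D$ be a Riemann surface obtained by inverting $p(\cdot,t)$ and continuing the inverse function $\lambda$ analytically. That is, $\mathcal D$ carries a holomorphic function $\lambda$ and contains a sheet $\mathbb{C}\setminus\bigcup_iL_i\hookrightarrow\mathcal D$, on which $\lambda$ is the identity. It also contains points $c_1,\dots,c_n$, where $c_i$ is the limit of the points of the sheet as $\lambda\to u_i$. A holomorphic function $p$, defined on an open set $N\subset\mathcal D$ that contains the sheet and the points $c_i$, equals $p(\lambda,t)$ on the sheet and is a local coordinate of $\mathcal D$ at each $c_i$. Nothing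 else is required of $\mathcal D$. Put $x=\lambda$ and $y=p$. **Theorem.** For every $i$ one has $x(c_i)=u_i$, and there is a local holomorphic coordinate $w_i$ of $\mathcal D$ centred at $c_i$ with $x=x(c_i)-w_i^2/2$ (so $c_i$ is a nondegenerate critical point of $x$) and with $w_i=\sqrt2\,\sqrt{u_i-\lambda}$ on the sheet near $c_i$. For every such coordinate $w_i$: 1. $\displaystyle \frac{dy}{dw_i}(0)=\Delta_i^{-1/2}.$ 2. To all orders in $\zeta^{-1}$, as $\zeta\to+\infty$, $$\frac{\sqrt\zeta}{\sqrt{2\pi}}\int_{-\infty}^{\infty}dy(w_i)\,e^{(x(w_i)-x(c_i))\zeta}\;\sim\;\sum_{k=1}^n\bigl(R^{-1}(\zeta^{-1})\bigr)^i_k\,\Delta_k^{-1/2}.$$ Here the right-hand side is the formal power series in $\zeta^{-1}$ given by the $i$-th coordinate of $R^{-1}(\zeta^{-1})$ applied to the unit vector. The integral is over the real line of the local coordinate $w_i$: the expansion holds for the integral over $(-\varepsilon,\varepsilon)$ for every sufficiently small $\varepsilon>0$. It also holds for the integral over all of $\mathbb{R}$ along any continuous path $\mathbb{R}\to N$ that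 extends the real line of $w_i$ with $x=x(c_i)-w_i^2/2$ along it, provided that this integral converges absolutely for some real value of $\zeta$. -/

import Mathlib

open Filter Topology Asymptotics
open scoped Manifold Matrix

noncomputable section

namespace Dubrovin

/-! ### Frobenius manifolds in flat coordinates -/

section Flat

variable {n : ℕ}

/-- The partial derivative `∂f/∂t^α` of a function on `ℂⁿ`. -/
def pd (α : Fin n) (f : (Fin n → ℂ) → ℂ) (t : Fin n → ℂ) : ℂ :=
  fderiv ℂ f t (Pi.single α 1)

/-- The pairing `η(a, b) = Σ η_{αβ} a^α b^β` of tangent vectors. -/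
def pairing (η : Matrix (Fin n) (Fin n) ℂ) (a b : Fin n → ℂ) : ℂ :=
  ∑ α, ∑ β, η α β * a α * b β

/-- The structure constants `C_{αβ}^γ = Σ_κ ∂³F/∂t^α∂t^β∂t^κ η^{κγ}`; the matrix `(η^{κγ})` is the
inverse of the Gram matrix `(η_{κγ})`. -/
def structureConst (F : (Fin n → ℂ) → ℂ) (η : Matrix (Fin n) (Fin n) ℂ) (t : Fin n → ℂ)
    (α β γ : Fin n) : ℂ :=
  ∑ κ, pd α (pd β (pd κ F)) t * η⁻¹ κ γ

/-- The product `a · b` of two tangent vectors at the point `t`. -/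
def tangentMul (F : (Fin n → ℂ) → ℂ) (η : Matrix (Fin n) (Fin n) ℂ) (t a b : Fin n → ℂ) :
    Fin n → ℂ :=
  fun γ => ∑ α, ∑ β, a α * b β * structureConst F η t α β γ

end Flat

/-- A (conformal) Frobenius manifold of rank `n` and conformal dimension `d`: a prepotential `F` on
a domain `B ⊆ ℂⁿ` with flat coordinates `t^α`, a constant inner product `η`, and an Euler vector
field `E = Σ_α ((1 - q_α) t^α + r_α) ∂_α`. The index `0 : Fin n` is the distinguished one
(`∂_0` is the unit field, written `∂_{t¹}` in one-based notation). -/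
structure FrobeniusManifold (n : ℕ) [NeZero n] where
  /-- the domain of the flat coordinates -/
  B : Set (Fin n → ℂ)
  isOpen_B : IsOpen B
  isConnected_B : IsConnected B
  /-- the prepotential -/
  F : (Fin n → ℂ) → ℂ
  holo_F : AnalyticOnNhd ℂ F B
  /-- the Gram matrix `(η_{αβ})` of the flat metric -/
  η : Matrix (Fin n) (Fin n) ℂ
  η_symm : η.IsSymm
  η_nondeg : IsUnit η.det
  mul_comm : ∀ t ∈ B, ∀ a b, tangentMul F η t a b = tangentMul F η t b a
  mul_assoc : ∀ t ∈ B, ∀ a b c,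
    tangentMul F η t (tangentMul F η t a b) c = tangentMul F η t a (tangentMul F η t b c)
  mul_pairing : ∀ t ∈ B, ∀ a b c,
    pairing η (tangentMul F η t a b) c = pairing η a (tangentMul F η t b c)
  unit_mul : ∀ t ∈ B, ∀ a, tangentMul F η t (Pi.single 0 1) a = a
  q : Fin n → ℂ
  r : Fin n → ℂ
  q_zero : q 0 = 0
  r_ne_zero : ∀ α, r α ≠ 0 → 1 - q α = 0
  /-- the conformal dimension -/
  d : ℂ
  homogeneous : ∃ P : MvPolynomial (Fin n) ℂ, P.totalDegree ≤ 2 ∧ ∀ t ∈ B,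
    ∑ α, ((1 - q α) * t α + r α) * pd α F t - (3 - d) * F t = MvPolynomial.eval t P

namespace FrobeniusManifold

variable {n : ℕ} [NeZero n] (M : FrobeniusManifold n)

/-- The Euler vector field in flat coordinates. -/
def euler (t : Fin n → ℂ) : Fin n → ℂ := fun α => (1 - M.q α) * t α + M.r α

/-- Multiplication of tangent vectors at `t`. -/
def mul (t a b : Fin n → ℂ) : Fin n → ℂ := tangentMul M.F M.η t a b

/-- The matrix, in the flat basis, of multiplication by the tangent vector `a` at `t`. -/
def mulMatrix (t a : Fin n → ℂ) : Matrix (Fin n) (Fin n) ℂ :=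
  Matrix.of fun γ β => M.mul t a (Pi.single β 1) γ

/-- The endomorphism `μ(v) = (1 - d/2) v - ∇_v E` in the flat basis, `diag(q_α - d/2)`. -/
def mu : Matrix (Fin n) (Fin n) ℂ := Matrix.diagonal fun α => M.q α - M.d / 2

end FrobeniusManifold

/-! ### Canonical coordinates on a semisimple domain -/

section Canonical

variable {n : ℕ}

/-- The Jacobian matrix `∂u_i/∂t^α`. -/
def jacobian (u : (Fin n → ℂ) → Fin n → ℂ) (t : Fin n → ℂ) : Matrix (Fin n) (Fin n) ℂ :=
  Matrix.of fun i α => pd α (fun s => u s i) t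

/-- The coordinate vector field `∂_{u_i} = Σ_α (∂t^α/∂u_i) ∂_α` of the coordinates `u`. -/
def coordField (u : (Fin n → ℂ) → Fin n → ℂ) (i : Fin n) (t : Fin n → ℂ) : Fin n → ℂ :=
  fun α => (jacobian u t)⁻¹ α i

end Canonical

/-- Canonical coordinates `u_1, …, u_n` on an open connected set `B₀` of semisimple points: the
coordinate fields `∂_{u_i}` are the idempotents of the product and `E = Σ_i u_i ∂_{u_i}`; together
with holomorphic branches of `Δ_i^{-1/2}`, where `Δ_i⁻¹ = η(∂_{u_i}, ∂_{u_i})`. -/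
structure CanonicalCoordinates {n : ℕ} [NeZero n] (M : FrobeniusManifold n) where
  B₀ : Set (Fin n → ℂ)
  isOpen_B₀ : IsOpen B₀
  isConnected_B₀ : IsConnected B₀
  subset_B : B₀ ⊆ M.B
  u : (Fin n → ℂ) → Fin n → ℂ
  holo_u : ∀ i, AnalyticOnNhd ℂ (fun t => u t i) B₀
  jacobian_nondeg : ∀ t ∈ B₀, IsUnit (jacobian u t).det
  idempotent : ∀ t ∈ B₀, ∀ i j,
    M.mul t (coordField u i t) (coordField u j t) = if i = j then coordField u i t else 0
  euler_eq : ∀ t ∈ B₀, M.euler t = ∑ i, u t i • coordField u i t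
  /-- `Δ_i^{-1/2}` -/
  invSqrtΔ : Fin n → (Fin n → ℂ) → ℂ
  holo_invSqrtΔ : ∀ i, AnalyticOnNhd ℂ (invSqrtΔ i) B₀
  invSqrtΔ_sq : ∀ t ∈ B₀, ∀ i,
    invSqrtΔ i t ^ 2 = pairing M.η (coordField u i t) (coordField u i t)

namespace CanonicalCoordinates

variable {n : ℕ} [NeZero n] {M : FrobeniusManifold n} (C : CanonicalCoordinates M)

/-- The transition matrix `Ψ` from the flat to the normalized canonical frame: column `α` holds the
coordinates of `∂_α = Σ_i (∂u_i/∂t^α) ∂_{u_i}` in the basis `Δ_i^{1/2} ∂_{u_i}`. -/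
def Psi (t : Fin n → ℂ) : Matrix (Fin n) (Fin n) ℂ :=
  Matrix.of fun i α => C.invSqrtΔ i t * jacobian C.u t i α

/-- The derivative `dΨ(v)`, entry by entry. -/
def dPsi (t v : Fin n → ℂ) : Matrix (Fin n) (Fin n) ℂ :=
  Matrix.of fun i α => fderiv ℂ (fun s => C.Psi s i α) t v

/-- `V = Ψ diag(μ_1, …, μ_n) Ψ⁻¹`. -/
def V (t : Fin n → ℂ) : Matrix (Fin n) (Fin n) ℂ := C.Psi t * M.mu * (C.Psi t)⁻¹

/-- `U = diag(u_1, …, u_n)`. -/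
def U (t : Fin n → ℂ) : Matrix (Fin n) (Fin n) ℂ := Matrix.diagonal (C.u t)

/-- The derivative `dU(v)`. -/
def dU (t v : Fin n → ℂ) : Matrix (Fin n) (Fin n) ℂ :=
  Matrix.diagonal fun i => fderiv ℂ (fun s => C.u s i) t v

/-- `R(z) = 1 + R_1 z + R_2 z² + ⋯`, a formal power series in `z` whose coefficients are matrix
functions on `B₀`, such that `Y = Ψ⁻¹ R(z⁻¹) e^{-zU}` is a formal fundamental matrix of flat
sections at `z = ∞` of the extended connection
`∇̃_{∂'} ∂'' = ∇_{∂'} ∂'' + z ∂'·∂''`, `∇̃_{∂_z} ∂' = ∂_z ∂' + E·∂' - z⁻¹ μ ∂'`.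
With `S_k = Ψ⁻¹ R_k`, the equations `∂_v Y + z v·Y = 0` and `∂_z Y + E·Y - z⁻¹ μ Y = 0` are
multiplied by `e^{zU}` on the right and compared coefficient by coefficient in `z`. -/
structure IsRMatrix (R : (Fin n → ℂ) → PowerSeries (Matrix (Fin n) (Fin n) ℂ)) : Prop where
  coeff_zero : ∀ t ∈ C.B₀, PowerSeries.coeff 0 (R t) = 1
  holo : ∀ k i j, AnalyticOnNhd ℂ (fun t => PowerSeries.coeff k (R t) i j) C.B₀
  flat_lead : ∀ t ∈ C.B₀, ∀ v,
    -((C.Psi t)⁻¹ * PowerSeries.coeff 0 (R t) * C.dU t v)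
      + M.mulMatrix t v * ((C.Psi t)⁻¹ * PowerSeries.coeff 0 (R t)) = 0
  flat : ∀ t ∈ C.B₀, ∀ v, ∀ k,
    (Matrix.of fun α i =>
        fderiv ℂ (fun s => ((C.Psi s)⁻¹ * PowerSeries.coeff k (R s)) α i) t v)
      - (C.Psi t)⁻¹ * PowerSeries.coeff (k + 1) (R t) * C.dU t v
      + M.mulMatrix t v * ((C.Psi t)⁻¹ * PowerSeries.coeff (k + 1) (R t)) = 0
  flat_z_lead : ∀ t ∈ C.B₀,
    -((C.Psi t)⁻¹ * PowerSeries.coeff 0 (R t) * C.U t)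
      + M.mulMatrix t (M.euler t) * ((C.Psi t)⁻¹ * PowerSeries.coeff 0 (R t)) = 0
  flat_z : ∀ t ∈ C.B₀, ∀ k : ℕ,
    -(k : ℂ) • ((C.Psi t)⁻¹ * PowerSeries.coeff k (R t))
      - (C.Psi t)⁻¹ * PowerSeries.coeff (k + 1) (R t) * C.U t
      + M.mulMatrix t (M.euler t) * ((C.Psi t)⁻¹ * PowerSeries.coeff (k + 1) (R t))
      - M.mu * ((C.Psi t)⁻¹ * PowerSeries.coeff k (R t)) = 0

end CanonicalCoordinates

/-- The inverse `R⁻¹(z)` of a matrix power series with constant term `1`. -/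
def invSeries {n : ℕ} (R : PowerSeries (Matrix (Fin n) (Fin n) ℂ)) :
    PowerSeries (Matrix (Fin n) (Fin n) ℂ) :=
  PowerSeries.invOfUnit R 1

/-- The coefficient of `z^m` in the `i`-th coordinate `Σ_k (R⁻¹(z))^i_k Δ_k^{-1/2}` of `R⁻¹(z)`
applied to the unit vector (the unit vector has coordinates `Δ_k^{-1/2}` in the normalized canonical
frame). -/
def invRUnitCoeff {n : ℕ} [NeZero n] {M : FrobeniusManifold n} (C : CanonicalCoordinates M)
    (R : (Fin n → ℂ) → PowerSeries (Matrix (Fin n) (Fin n) ℂ)) (t : Fin n → ℂ) (i : Fin n)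
    (m : ℕ) : ℂ :=
  ∑ k, PowerSeries.coeff m (invSeries (R t)) i k * C.invSqrtΔ k t

/-! ### The extended Gauss-Manin system and the superpotential -/

/-- The ray from `a` to infinity in the direction `ν`. -/
def ray (a ν : ℂ) : Set ℂ := {lam | ∃ s : ℝ, 0 ≤ s ∧ lam = a + s * ν}

/-- The complex plane without the parallel cuts from the points `a_i` in the direction `ν`. -/
def slitPlane {n : ℕ} (a : Fin n → ℂ) (ν : ℂ) : Set ℂ := (⋃ i, ray (a i) ν)ᶜ

/-- Parallel cuts `L_i` from the points `u_i` to infinity, with `u_j ∉ L_i` for `i ≠ j`, and branches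
of the functions `√(u_i - λ)` off the cuts. -/
structure Cuts {n : ℕ} [NeZero n] {M : FrobeniusManifold n} (C : CanonicalCoordinates M) where
  /-- the common direction of the cuts -/
  ν : ℂ
  ν_ne_zero : ν ≠ 0
  not_mem_ray : ∀ t ∈ C.B₀, ∀ i j, i ≠ j → C.u t j ∉ ray (C.u t i) ν
  /-- the branch of `√(u_i - λ)`, as a function of `(λ, t)` -/
  root : Fin n → ℂ × (Fin n → ℂ) → ℂ
  continuousOn_root : ∀ i,
    ContinuousOn (root i) {x | x.2 ∈ C.B₀ ∧ x.1 ∈ slitPlane (C.u x.2) ν}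
  root_sq : ∀ i, ∀ x : ℂ × (Fin n → ℂ), x.2 ∈ C.B₀ → x.1 ∈ slitPlane (C.u x.2) ν →
    root i x ^ 2 = C.u x.2 i - x.1

/-- `g` is obtained from `f` by analytic continuation once counterclockwise along a small loop around
the point `a`; both functions live on a punctured neighbourhood of `a` cut along the ray from `a` in
the direction `ν`. The continuation takes place on the universal cover `ζ ↦ a + e^ζ` of a punctured
disc. -/
def IsMonodromy {E : Type*} [NormedAddCommGroup E] [NormedSpace ℂ E] (a ν : ℂ) (f g : ℂ → E) :
    Prop :=
  ∃ ρ : ℝ, ∃ h : ℂ → E, DifferentiableOn ℂ h {ζ | ζ.re < ρ} ∧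
    ∀ ζ : ℂ, ζ.re < ρ → ν.arg < ζ.im → ζ.im < ν.arg + 2 * Real.pi →
      h ζ = f (a + Complex.exp ζ) ∧
      h (ζ + 2 * Real.pi * Complex.I) = g (a + Complex.exp ζ)

section GaussManin

variable {n : ℕ} [NeZero n] {M : FrobeniusManifold n} {C : CanonicalCoordinates M} (K : Cuts C)

/-- The set of all `(λ, t)` with `t ∈ B₀` and `λ ∈ ℂ ∖ ⋃_i L_i`. -/
def Cuts.domain : Set (ℂ × (Fin n → ℂ)) :=
  {x | x.2 ∈ C.B₀ ∧ x.1 ∈ slitPlane (C.u x.2) K.ν}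

/-- `f` is a solution off the cuts of the extended Gauss-Manin system
`df = -(U - λ)⁻¹ d(U - λ) (1/2 + V) f + dΨ Ψ⁻¹ f`, where `d` is the total differential in
`(λ, t)`; the equation is stated on every tangent vector `v = (λ', t')`. -/
def IsGaussManinSolution (f : ℂ × (Fin n → ℂ) → Fin n → ℂ) : Prop :=
  ∀ x ∈ K.domain, DifferentiableAt ℂ f x ∧ ∀ v : ℂ × (Fin n → ℂ),
    fderiv ℂ f x v =
      -((Matrix.diagonal fun i => (C.u x.2 i - x.1)⁻¹)
          * (C.dU x.2 v.2 - Matrix.diagonal fun _ => v.1)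
          * ((Matrix.diagonal fun _ => (1 / 2 : ℂ)) + C.V x.2)) *ᵥ f x
        + (C.dPsi x.2 v.2 * (C.Psi x.2)⁻¹) *ᵥ f x

/-- The system of solutions `φ^(1), …, φ^(n)`: `φ^(j)` changes its sign under the monodromy around
`u_j`, `φ^(j)_j = 1/√(u_j - λ) + O(√(u_j - λ))`, and `φ^(j)_a = √(u_j - λ) · O(1)` for `a ≠ j`, as
`λ → u_j`. -/
structure IsDubrovinSystem (φ : Fin n → ℂ × (Fin n → ℂ) → Fin n → ℂ) : Prop where
  solution : ∀ j, IsGaussManinSolution K (φ j)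
  monodromy : ∀ t ∈ C.B₀, ∀ j,
    IsMonodromy (C.u t j) K.ν (fun lam => φ j (lam, t)) (fun lam => -φ j (lam, t))
  asymp_diag : ∀ t ∈ C.B₀, ∀ j,
    (fun lam => φ j (lam, t) j - 1 / K.root j (lam, t))
      =O[𝓝[slitPlane (C.u t) K.ν] (C.u t j)] fun lam => K.root j (lam, t)
  asymp_off : ∀ t ∈ C.B₀, ∀ j a, a ≠ j →
    (fun lam => φ j (lam, t) a)
      =O[𝓝[slitPlane (C.u t) K.ν] (C.u t j)] fun lam => K.root j (lam, t)

/-- Dubrovin's system of solutions, the constant matrix `G^{ij} = (φ^(i))ᵀ (U - λ) φ^(j)`, and a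
vector `γ` with `G γ = (1, …, 1)`. If `G` is nondegenerate with inverse `(G_{ij})`, then
`γ_j = Σ_i G_{ij}` is the only choice (see `gamma_eq`); a degenerate `G` is also admitted. -/
structure SuperpotentialData where
  φ : Fin n → ℂ × (Fin n → ℂ) → Fin n → ℂ
  isDubrovinSystem : IsDubrovinSystem K φ
  G : Matrix (Fin n) (Fin n) ℂ
  G_eq : ∀ x ∈ K.domain, ∀ i j, G i j = ∑ a, φ i x a * (C.u x.2 a - x.1) * φ j x a
  γ : Fin n → ℂ
  G_mul_γ : ∀ i, ∑ j, G i j * γ j = 1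

variable {K}

/-- The special solution `φ = Σ_j γ_j φ^(j)`, that is `Σ_{i,j} G_{ij} φ^(j)` for nondegenerate
`G`. -/
def SuperpotentialData.phi (S : SuperpotentialData K) (x : ℂ × (Fin n → ℂ)) : Fin n → ℂ :=
  ∑ j, S.γ j • S.φ j x

/-- The function `p(λ, t) = √2/(1 - d) · φᵀ (U - λ) Ψ 𝟙`, where `𝟙` is the unit vector in the flat
basis. -/
def SuperpotentialData.P (S : SuperpotentialData K) (x : ℂ × (Fin n → ℂ)) : ℂ :=
  (Real.sqrt 2 : ℂ) / (1 - M.d) * ∑ i, S.phi x i * (C.u x.2 i - x.1) * C.Psi x.2 i 0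

theorem SuperpotentialData.gamma_eq (S : SuperpotentialData K) (hG : IsUnit S.G.det) (j : Fin n) :
    S.γ j = ∑ i, S.G⁻¹ j i := by
  have h : S.G *ᵥ S.γ = fun _ => 1 := by
    funext i
    simpa [Matrix.mulVec, dotProduct] using S.G_mul_γ i
  have h2 : S.γ = S.G⁻¹ *ᵥ (fun _ => (1 : ℂ)) := by
    rw [← h, Matrix.mulVec_mulVec, Matrix.nonsing_inv_mul _ hG, Matrix.one_mulVec]
  conv_lhs => rw [h2]
  simp [Matrix.mulVec, dotProduct]

end GaussManin

/-! ### The Riemann surface of the superpotential -/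

section Curve

variable {n : ℕ} [NeZero n] {M : FrobeniusManifold n} {C : CanonicalCoordinates M} {K : Cuts C}

/-- A Riemann surface `𝒟` obtained by inverting `p(·, t)` and continuing the inverse function.

The inverse function is single-valued on the sheet `ℂ ∖ ⋃_i L_i ↪ 𝒟`, `λ ↦ sheet λ`, on which it is
the coordinate `λ` and which is spread over the `p`-plane by the function `p(λ, t)`. It is continued,
as a holomorphic function of `p`, beyond the boundary of this sheet, in particular to neighbourhoods
of the boundary points `c_i = p(u_i, t)`. The continuation is not unique, so nothing is required of
the rest of `𝒟`; there `p` may be multivalued, and `p` is the branch on a neighbourhood `N` of the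
sheet and of the points `c_i`. -/
structure DubrovinCurve (S : SuperpotentialData K) (t : Fin n → ℂ) (D : Type*)
    [TopologicalSpace D] [ChartedSpace ℂ D] where
  /-- the function `λ` on `𝒟` -/
  lam : D → ℂ
  holo_lam : MDifferentiable 𝓘(ℂ, ℂ) 𝓘(ℂ, ℂ) lam
  /-- the domain of the branch of `p` -/
  N : Set D
  isOpen_N : IsOpen N
  /-- the function `p` on `N` -/
  p : D → ℂ
  holo_p : MDifferentiableOn 𝓘(ℂ, ℂ) 𝓘(ℂ, ℂ) p N
  /-- the initial sheet -/
  sheet : ℂ → D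
  holo_sheet : MDifferentiableOn 𝓘(ℂ, ℂ) 𝓘(ℂ, ℂ) sheet (slitPlane (C.u t) K.ν)
  sheet_mem : ∀ z ∈ slitPlane (C.u t) K.ν, sheet z ∈ N
  lam_sheet : ∀ z ∈ slitPlane (C.u t) K.ν, lam (sheet z) = z
  p_sheet : ∀ z ∈ slitPlane (C.u t) K.ν, p (sheet z) = S.P (z, t)
  /-- the points `c_i` -/
  c : Fin n → D
  c_mem : ∀ i, c i ∈ N
  tendsto_sheet : ∀ i, Tendsto sheet (𝓝[slitPlane (C.u t) K.ν] (C.u t i)) (𝓝 (c i))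
  /-- `p` is a local coordinate of `𝒟` at `c_i` -/
  coord_p : ∀ i, mfderiv 𝓘(ℂ, ℂ) 𝓘(ℂ, ℂ) p (c i) ≠ 0

/-- `w` is a local holomorphic coordinate of `𝒟` centred at `c_i` in which `x = λ` has the form
`x = x(c_i) - w²/2`; its sign is fixed by `w = √2 · √(u_i - λ)` on the initial sheet near `c_i`. -/
structure DubrovinCurve.IsLocalCoord {S : SuperpotentialData K} {t : Fin n → ℂ} {D : Type*}
    [TopologicalSpace D] [ChartedSpace ℂ D] (X : DubrovinCurve S t D) (i : Fin n)
    (w : OpenPartialHomeomorph D ℂ) : Prop where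
  mem_atlas : w ∈ IsManifold.maximalAtlas 𝓘(ℂ, ℂ) 1 D
  mem_source : X.c i ∈ w.source
  center : w (X.c i) = 0
  x_eq : ∀ z ∈ w.source, X.lam z = X.lam (X.c i) - w z ^ 2 / 2
  sign : ∀ᶠ z in 𝓝[slitPlane (C.u t) K.ν] (C.u t i),
    w (X.sheet z) = (Real.sqrt 2 : ℂ) * K.root i (z, t)

/-- `γ : ℝ → 𝒟` is a path through `c_i` that extends the real line of the local coordinate `w` to all
of `ℝ`, keeping `x(γ(s)) = x(c_i) - s²/2` and staying in the domain of `p`. -/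
structure DubrovinCurve.IsRealLine {S : SuperpotentialData K} {t : Fin n → ℂ} {D : Type*}
    [TopologicalSpace D] [ChartedSpace ℂ D] (X : DubrovinCurve S t D) (i : Fin n)
    (w : OpenPartialHomeomorph D ℂ) (γ : ℝ → D) : Prop where
  continuous : Continuous γ
  mem_N : ∀ s, γ s ∈ X.N
  x_eq : ∀ s, X.lam (γ s) = X.lam (X.c i) - (s : ℂ) ^ 2 / 2
  eq_symm : ∀ᶠ s : ℝ in 𝓝 0, γ s = w.symm (s : ℂ)

end Curve

/-- `√ζ/√(2π) · ∫_I g(w) e^{-ζ w²/2} dw` has the asymptotic expansion `Σ_m a_m ζ^{-m}` as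
`ζ → +∞`, to all orders. -/
def HasLaplaceExpansion (g : ℝ → ℂ) (I : Set ℝ) (a : ℕ → ℂ) : Prop :=
  ∀ m : ℕ, (fun ζ : ℝ =>
      ((Real.sqrt ζ / Real.sqrt (2 * Real.pi) : ℝ) : ℂ)
          * (∫ w in I, g w * Complex.exp (-(ζ : ℂ) * (w : ℂ) ^ 2 / 2))
        - ∑ k ∈ Finset.range m, a k * (ζ : ℂ)⁻¹ ^ k)
    =O[atTop] fun ζ : ℝ => (ζ⁻¹) ^ m

end Dubrovin

end

/-!
Fix `t` and write `u_i`, `V`, `Ψ` for the values at `t`. The homogeneity of the prepotential forces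
`(q_β + q_κ - d) η_{βκ} = 0` (`FrobeniusManifold.q_add_q_sub_d_mul_eta`), and `Ψᵀ Ψ = η`; hence `V` is
antisymmetric, and the unit vector `Ψ 𝟙 = (Δ_k^{-1/2})_k` is an eigenvector of `V` with eigenvalue
`-d/2`. Two consequences: for solutions `f`, `g` of `(U - λ) f' = (1/2 + V) f` the number
`fᵀ (U - λ) g` is constant, and the derivative of the superpotential is `-(1/√2) φᵀ Ψ 𝟙`
(`SuperpotentialData.hasDerivAt_P`).

The flatness of `Ψ⁻¹ R(z⁻¹) e^{-zU}` in the direction `∂_z` is the recursion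
`[U, R_{k+1}] = (k + V) R_k`. By the antisymmetry of `V`, the `i`-th rows `q_k` of the coefficients of
`R⁻¹` then satisfy `(u_i - U) q_{k+1} = (k + V) q_k`. Divided by `(1/2)(3/2)⋯(k - 1/2)` this is the
recursion for the coefficients of a solution of the form `Σ_k f_k (u_i - λ)^{k - 1/2}`
(`CanonicalCoordinates.IsRMatrix.isFrobeniusSeries`), so this Borel transform of a row of `R⁻¹` is the
singular solution at `u_i`. The recursion has two terms only, because the system is linear in `λ`, so
the series converges (`exists_radius`). In the same way one gets `n - 1` holomorphic solutions at
`u_i`. These `n` solutions are orthogonal for the constant form `fᵀ (U - λ) g`, whose values are read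
off from the leading terms at `u_i`. Therefore `φ^(i)` is the singular solution, and `G γ = (1, …, 1)`
says that `φ` is `φ^(i)` plus a solution holomorphic at `u_i`
(`IsLocalSolution.eq_singular_add_regular`).

Integrating, `p = √(u_i - λ) A(u_i - λ) + B(u_i - λ)` with convergent power series `A` and `B`
(`SuperpotentialData.exists_P_eq`). With `w = √2 √(u_i - λ)` this is a holomorphic function of `w`
whose derivative has the even part `Σ_k (R⁻¹_k 𝟙)_i / ((1/2)(3/2)⋯(k - 1/2)) (w²/2)^k` and the value
`Δ_i^{-1/2} ≠ 0` at `0`. The local coordinate `w_i` on the curve is the inverse of this function applied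
to `p`; that `λ = u_i - w_i²/2`, and that `p` is this function of every admissible `w_i`, holds on the
sheet and thus near `c_i` by the identity theorem. Finally, by Watson's lemma
(`hasLaplaceExpansion_of_eq`), the odd part does not contribute to the Laplace integral, and the
moment of `(w²/2)^k` is `(1/2)(3/2)⋯(k - 1/2) ζ^{-k}`, which undoes the Borel transform.
-/

noncomputable section

namespace Dubrovin

/-! ### Homogeneity of the flat metric -/

section Derivatives

variable {n : ℕ}

/-- `∂_α f` is the derivative of `f` along the coordinate line through `t`. -/
theorem hasDerivAt_line {f : (Fin n → ℂ) → ℂ} {t : Fin n → ℂ} (hf : DifferentiableAt ℂ f t)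
    (α : Fin n) :
    HasDerivAt (fun s : ℂ => f (t + s • Pi.single α 1)) (pd α f t) 0 := by
  have h1 : HasDerivAt (fun s : ℂ => t + s • (Pi.single α 1 : Fin n → ℂ)) (Pi.single α 1) 0 := by
    simpa using ((hasDerivAt_id (0 : ℂ)).smul_const (Pi.single α 1 : Fin n → ℂ)).const_add t
  have h2 : HasFDerivAt f (fderiv ℂ f t) (t + (0 : ℂ) • (Pi.single α 1 : Fin n → ℂ)) := by
    simpa using hf.hasFDerivAt
  exact h2.comp_hasDerivAt 0 h1

theorem analyticOnNhd_pd {f : (Fin n → ℂ) → ℂ} {B : Set (Fin n → ℂ)} (hf : AnalyticOnNhd ℂ f B)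
    (α : Fin n) : AnalyticOnNhd ℂ (pd α f) B :=
  (ContinuousLinearMap.apply ℂ ℂ (Pi.single α 1 : Fin n → ℂ)).comp_analyticOnNhd hf.fderiv

theorem pd_comm {f : (Fin n → ℂ) → ℂ} {B : Set (Fin n → ℂ)} (hf : AnalyticOnNhd ℂ f B)
    {t : Fin n → ℂ} (ht : t ∈ B) (α β : Fin n) : pd α (pd β f) t = pd β (pd α f) t := by
  have hs : IsSymmSndFDerivAt ℂ f t :=
    ((hf t ht).contDiffAt (n := ⊤)).isSymmSndFDerivAt le_top
  have hd : DifferentiableAt ℂ (fderiv ℂ f) t := (hf.fderiv t ht).differentiableAt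
  have key : ∀ a b : Fin n, pd a (pd b f) t
      = fderiv ℂ (fderiv ℂ f) t (Pi.single a 1) (Pi.single b 1) := by
    intro a b
    have : HasFDerivAt (pd b f)
        ((ContinuousLinearMap.apply ℂ ℂ (Pi.single b 1 : Fin n → ℂ)).comp
          (fderiv ℂ (fderiv ℂ f) t)) t :=
      (ContinuousLinearMap.apply ℂ ℂ (Pi.single b 1 : Fin n → ℂ)).hasFDerivAt.comp t
        hd.hasFDerivAt
    rw [pd, this.fderiv]
    rfl
  rw [key, key]
  exact hs _ _

theorem pd_eval (P : MvPolynomial (Fin n) ℂ) (β : Fin n) (t : Fin n → ℂ) :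
    HasDerivAt (fun s : ℂ => MvPolynomial.eval (t + s • Pi.single β 1) P)
      (MvPolynomial.eval t (MvPolynomial.pderiv β P)) 0 := by
  induction P using MvPolynomial.induction_on with
  | C a => simpa using hasDerivAt_const (0 : ℂ) a
  | add p q hp hq => simpa using hp.fun_add hq
  | mul_X p i hp =>
    have hX : HasDerivAt (fun s : ℂ => (t + s • (Pi.single β 1 : Fin n → ℂ)) i)
        ((Pi.single β 1 : Fin n → ℂ) i) 0 := by
      simpa using ((hasDerivAt_id (0 : ℂ)).mul_const ((Pi.single β 1 : Fin n → ℂ) i)).const_add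
        (t i)
    have := hp.mul hX
    simp only [zero_smul, add_zero] at this
    convert! this using 1
    · funext s; simp
    · rw [MvPolynomial.pderiv_mul, MvPolynomial.pderiv_X]
      simp only [map_add, map_mul, MvPolynomial.eval_X]
      congr 2
      by_cases h : i = β
      · subst h; simp
      · simp [h]

theorem pderiv_pderiv_pderiv_eq_zero {P : MvPolynomial (Fin n) ℂ} (hP : P.totalDegree ≤ 2)
    (α β κ : Fin n) :
    MvPolynomial.pderiv α (MvPolynomial.pderiv β (MvPolynomial.pderiv κ P)) = 0 := by
  ext m
  simp only [MvPolynomial.coeff_pderiv, MvPolynomial.coeff_zero]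
  rw [MvPolynomial.coeff_eq_zero_of_totalDegree_lt]
  · simp
  · refine lt_of_le_of_lt hP ?_
    have : ((m + Finsupp.single α 1 + Finsupp.single β 1 + Finsupp.single κ 1).degree : ℕ)
        = m.degree + 1 + 1 + 1 := by
      simp [map_add]
    rw [Finsupp.degree_apply] at this
    omega

/-- Differentiating a homogeneity relation `E.G - c G = P` along `∂_β` lowers the weight `c` by
`1 - q_β`. -/
theorem homogeneous_pd {G : (Fin n → ℂ) → ℂ} {B : Set (Fin n → ℂ)} (hB : IsOpen B)
    (hG : AnalyticOnNhd ℂ G B) {q r : Fin n → ℂ} {c : ℂ} {P : MvPolynomial (Fin n) ℂ}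
    (h : ∀ t ∈ B, ∑ α, ((1 - q α) * t α + r α) * pd α G t - c * G t = MvPolynomial.eval t P)
    (β : Fin n) :
    ∀ t ∈ B, ∑ α, ((1 - q α) * t α + r α) * pd α (pd β G) t - (c - (1 - q β)) * pd β G t
      = MvPolynomial.eval t (MvPolynomial.pderiv β P) := by
  intro t ht
  have hE : ∀ α, HasDerivAt
      (fun s : ℂ => (1 - q α) * (t + s • (Pi.single β 1 : Fin n → ℂ)) α + r α)
      ((1 - q α) * (Pi.single β 1 : Fin n → ℂ) α) 0 := by
    intro α
    simpa using ((((hasDerivAt_id (0 : ℂ)).mul_const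
      ((Pi.single β 1 : Fin n → ℂ) α)).const_add (t α)).const_mul (1 - q α)).add_const (r α)
  have h1 := (HasDerivAt.fun_sum fun α (_ : α ∈ Finset.univ) => (hE α).mul
    (hasDerivAt_line ((analyticOnNhd_pd hG α) t ht).differentiableAt β)).sub
    ((hasDerivAt_line (hG t ht).differentiableAt β).const_mul c)
  have hev : ∀ᶠ s : ℂ in 𝓝 0, t + s • (Pi.single β 1 : Fin n → ℂ) ∈ B := by
    have hc : Continuous fun s : ℂ => t + s • (Pi.single β 1 : Fin n → ℂ) := by fun_prop
    exact hc.continuousAt.eventually (hB.mem_nhds (by simpa using ht))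
  have h2 := h1.unique ((pd_eval P β t).congr_of_eventuallyEq
    (hev.mono fun s hs => by simpa using h _ hs))
  simp only [zero_smul, add_zero] at h2
  rw [← h2, Finset.sum_add_distrib]
  have h3 : ∑ α, (1 - q α) * (Pi.single β 1 : Fin n → ℂ) α * pd α G t
      = (1 - q β) * pd β G t := by
    rw [Finset.sum_eq_single β] <;> simp +contextual
  rw [h3]
  have h4 : ∀ α, pd α (pd β G) t = pd β (pd α G) t := fun α => pd_comm hG ht α β
  simp only [h4]
  ring

end Derivatives

namespace FrobeniusManifold

variable {n : ℕ} [NeZero n] (M : FrobeniusManifold n)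

theorem structureConst_zero {t : Fin n → ℂ} (ht : t ∈ M.B) (β γ : Fin n) :
    structureConst M.F M.η t 0 β γ = if β = γ then 1 else 0 := by
  have h := congrFun (M.unit_mul t ht (Pi.single β 1)) γ
  rw [tangentMul, Finset.sum_eq_single 0 (by simp +contextual [Pi.single_apply]) (by simp),
    Finset.sum_eq_single β (by simp +contextual) (by simp)] at h
  simpa [Pi.single_apply, eq_comm] using h

theorem pd_zero_pd_pd {t : Fin n → ℂ} (ht : t ∈ M.B) (β κ : Fin n) :
    pd 0 (pd β (pd κ M.F)) t = M.η β κ := by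
  have h : (Matrix.of fun β κ => pd 0 (pd β (pd κ M.F)) t) * M.η⁻¹ = 1 := by
    ext β γ
    rw [Matrix.mul_apply, Matrix.one_apply]
    exact M.structureConst_zero ht β γ
  have h2 := congrArg (· * M.η) h
  simp only [Matrix.mul_assoc, Matrix.nonsing_inv_mul _ M.η_nondeg, Matrix.mul_one,
    Matrix.one_mul] at h2
  exact congrFun (congrFun h2 β) κ

/-- The weights of the flat metric: `η` pairs flat directions with `q_β + q_κ = d`. -/
theorem q_add_q_sub_d_mul_eta (β κ : Fin n) : (M.q β + M.q κ - M.d) * M.η β κ = 0 := by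
  obtain ⟨P, hP, h⟩ := M.homogeneous
  obtain ⟨t, ht⟩ := M.isConnected_B.nonempty
  have hκ := analyticOnNhd_pd M.holo_F κ
  have hβ := analyticOnNhd_pd hκ β
  have h3 := homogeneous_pd M.isOpen_B hβ (homogeneous_pd M.isOpen_B hκ
    (homogeneous_pd M.isOpen_B M.holo_F h κ) β) 0 t ht
  rw [pderiv_pderiv_pderiv_eq_zero hP, map_zero] at h3
  have h0 : ∀ α, pd α (pd 0 (pd β (pd κ M.F))) t = 0 := by
    intro α
    have : pd 0 (pd β (pd κ M.F)) =ᶠ[𝓝 t] fun _ => M.η β κ :=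
      (M.isOpen_B.mem_nhds ht |> fun hB => Filter.mem_of_superset hB
        fun s hs => M.pd_zero_pd_pd hs β κ)
    rw [pd, this.fderiv_eq]
    simp
  simp only [h0, M.pd_zero_pd_pd ht, M.q_zero, mul_zero, Finset.sum_const_zero] at h3
  linear_combination -h3

theorem eta_mul_mu : M.η * M.mu = -(M.mu * M.η) := by
  ext β κ
  have := M.q_add_q_sub_d_mul_eta β κ
  rw [mu, Matrix.mul_diagonal, Matrix.neg_apply, Matrix.diagonal_mul]
  linear_combination this

end FrobeniusManifold

/-! ### The normalized canonical frame -/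

theorem pairing_eq_dotProduct {n : ℕ} (η : Matrix (Fin n) (Fin n) ℂ) (a b : Fin n → ℂ) :
    pairing η a b = a ⬝ᵥ (η *ᵥ b) := by
  simp only [pairing, dotProduct, Matrix.mulVec, Finset.mul_sum]
  exact Finset.sum_congr rfl fun α _ => Finset.sum_congr rfl fun β _ => by ring

/-- Multiplication by `b` on the right, as a linear map. -/
def tangentMulRight {n : ℕ} (F : (Fin n → ℂ) → ℂ) (η : Matrix (Fin n) (Fin n) ℂ)
    (t b : Fin n → ℂ) : (Fin n → ℂ) →ₗ[ℂ] (Fin n → ℂ) where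
  toFun a := tangentMul F η t a b
  map_add' a a' := by
    funext γ
    simp only [tangentMul, Pi.add_apply, add_mul, Finset.sum_add_distrib]
  map_smul' c a := by
    funext γ
    simp only [tangentMul, Pi.smul_apply, smul_eq_mul, mul_assoc, Finset.mul_sum, RingHom.id_apply]

namespace CanonicalCoordinates

variable {n : ℕ} [NeZero n] {M : FrobeniusManifold n} (C : CanonicalCoordinates M)
  {t : Fin n → ℂ}

theorem pairing_coordField_of_ne (ht : t ∈ C.B₀) {i j : Fin n} (hij : i ≠ j) :
    pairing M.η (coordField C.u i t) (coordField C.u j t) = 0 := by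
  have h1 := C.idempotent t ht i i
  have h2 := C.idempotent t ht i j
  rw [if_pos rfl] at h1
  rw [if_neg hij] at h2
  have h3 := M.mul_pairing t (C.subset_B ht) (coordField C.u i t) (coordField C.u i t)
    (coordField C.u j t)
  rw [FrobeniusManifold.mul] at h1 h2
  rw [h1, h2] at h3
  rw [h3]
  simp [pairing]

theorem gram_coordField (ht : t ∈ C.B₀) :
    ((jacobian C.u t)⁻¹)ᵀ * M.η * (jacobian C.u t)⁻¹
      = Matrix.diagonal fun i => C.invSqrtΔ i t ^ 2 := by
  ext i j
  have h : (((jacobian C.u t)⁻¹)ᵀ * M.η * (jacobian C.u t)⁻¹) i j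
      = pairing M.η (coordField C.u i t) (coordField C.u j t) := by
    rw [pairing_eq_dotProduct, Matrix.mul_assoc, Matrix.mul_apply]
    rfl
  rw [h]
  by_cases hij : i = j
  · subst hij
    rw [Matrix.diagonal_apply_eq, C.invSqrtΔ_sq t ht]
  · rw [Matrix.diagonal_apply_ne _ hij, C.pairing_coordField_of_ne ht hij]

theorem Psi_eq : C.Psi t = Matrix.diagonal (fun i => C.invSqrtΔ i t) * jacobian C.u t := by
  ext i α
  rw [Matrix.diagonal_mul]
  rfl

/-- The normalized canonical frame is orthonormal. -/
theorem Psi_transpose_mul_Psi (ht : t ∈ C.B₀) : (C.Psi t)ᵀ * C.Psi t = M.η := by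
  have hJ := C.jacobian_nondeg t ht
  have hd : Matrix.diagonal (fun i => C.invSqrtΔ i t) * Matrix.diagonal (fun i => C.invSqrtΔ i t)
      = ((jacobian C.u t)⁻¹)ᵀ * M.η * (jacobian C.u t)⁻¹ := by
    rw [C.gram_coordField ht, Matrix.diagonal_mul_diagonal]
    simp only [sq]
  rw [Psi_eq, Matrix.transpose_mul, Matrix.diagonal_transpose, Matrix.mul_assoc,
    ← Matrix.mul_assoc (Matrix.diagonal _), hd, Matrix.mul_assoc, Matrix.mul_assoc,
    Matrix.nonsing_inv_mul _ hJ, Matrix.mul_one, ← Matrix.mul_assoc, ← Matrix.transpose_mul,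
    Matrix.nonsing_inv_mul _ hJ, Matrix.transpose_one, Matrix.one_mul]

theorem isUnit_det_Psi (ht : t ∈ C.B₀) : IsUnit (C.Psi t).det := by
  have h := M.η_nondeg
  rw [← C.Psi_transpose_mul_Psi ht, Matrix.det_mul] at h
  exact isUnit_of_mul_isUnit_right h

theorem invSqrtΔ_ne_zero (ht : t ∈ C.B₀) (i : Fin n) : C.invSqrtΔ i t ≠ 0 := by
  have h := C.isUnit_det_Psi ht
  rw [Psi_eq, Matrix.det_mul, Matrix.det_diagonal] at h
  exact Finset.prod_ne_zero_iff.1 (isUnit_of_mul_isUnit_left h).ne_zero i (Finset.mem_univ i)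

/-- The unit field is the sum of the idempotents. -/
theorem jacobian_zero (ht : t ∈ C.B₀) (i : Fin n) : jacobian C.u t i 0 = 1 := by
  have hJ := C.jacobian_nondeg t ht
  have he : (Pi.single 0 1 : Fin n → ℂ) = ∑ j, jacobian C.u t j 0 • coordField C.u j t := by
    funext α
    have h := congrFun (congrFun (Matrix.nonsing_inv_mul _ hJ) α) 0
    rw [Matrix.mul_apply, Matrix.one_apply] at h
    simp only [Finset.sum_apply, Pi.smul_apply, smul_eq_mul, coordField, Pi.single_apply]
    rw [← h]
    exact Finset.sum_congr rfl fun j _ => mul_comm _ _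
  have h1 := M.unit_mul t (C.subset_B ht) (coordField C.u i t)
  change tangentMulRight M.F M.η t (coordField C.u i t) (Pi.single 0 1) = _ at h1
  rw [he, map_sum, Finset.sum_eq_single i] at h1
  · rw [map_smul] at h1
    have h2 := C.idempotent t ht i i
    rw [if_pos rfl] at h2
    change tangentMulRight M.F M.η t (coordField C.u i t) (coordField C.u i t) = _ at h2
    rw [h2] at h1
    have hne : coordField C.u i t ≠ 0 := by
      intro h0
      have h := congrFun (congrFun (Matrix.mul_nonsing_inv _ hJ) i) i
      rw [Matrix.mul_apply, Matrix.one_apply_eq] at h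
      have h3 : ∀ α, (jacobian C.u t)⁻¹ α i = 0 := fun α => congrFun h0 α
      simp [h3] at h
    by_contra hc
    apply hne
    have h4 : (jacobian C.u t i 0 - 1) • coordField C.u i t = 0 := by
      rw [sub_smul, h1, one_smul, sub_self]
    exact (smul_eq_zero.1 h4).resolve_left (sub_ne_zero.2 hc)
  · intro j _ hj
    rw [map_smul]
    have h2 := C.idempotent t ht j i
    rw [if_neg hj] at h2
    change tangentMulRight M.F M.η t (coordField C.u i t) (coordField C.u j t) = _ at h2
    rw [h2, smul_zero]
  · simp

theorem Psi_zero (ht : t ∈ C.B₀) (i : Fin n) : C.Psi t i 0 = C.invSqrtΔ i t := by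
  simp [Psi, C.jacobian_zero ht]

theorem V_mul_Psi (ht : t ∈ C.B₀) : C.V t * C.Psi t = C.Psi t * M.mu := by
  rw [V, Matrix.mul_assoc, Matrix.nonsing_inv_mul _ (C.isUnit_det_Psi ht), Matrix.mul_one]

/-- `V` is antisymmetric: `Ψᵀ Ψ = η`, and `μ` is antisymmetric with respect to `η`. -/
theorem V_transpose (ht : t ∈ C.B₀) : (C.V t)ᵀ = -C.V t := by
  have hP := C.isUnit_det_Psi ht
  have hPt : IsUnit ((C.Psi t)ᵀ).det := by rwa [Matrix.det_transpose]
  have h := M.eta_mul_mu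
  rw [← C.Psi_transpose_mul_Psi ht] at h
  have h2 : C.V t = ((C.Psi t)ᵀ)⁻¹ * ((C.Psi t)ᵀ * C.Psi t * M.mu) * (C.Psi t)⁻¹ := by
    rw [V, Matrix.mul_assoc _ _ M.mu, ← Matrix.mul_assoc, ← Matrix.mul_assoc,
      Matrix.nonsing_inv_mul _ hPt, Matrix.one_mul]
  have h3 : (C.V t)ᵀ = ((C.Psi t)ᵀ)⁻¹ * (M.mu * ((C.Psi t)ᵀ * C.Psi t)) * (C.Psi t)⁻¹ := by
    rw [V, Matrix.transpose_mul, Matrix.transpose_mul, Matrix.transpose_nonsing_inv,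
      FrobeniusManifold.mu, Matrix.diagonal_transpose]
    simp only [Matrix.mul_assoc]
    rw [Matrix.mul_nonsing_inv _ hP, Matrix.mul_one]
  rw [h3, h2, h, Matrix.mul_neg, Matrix.neg_mul, neg_neg]

theorem V_apply_swap (ht : t ∈ C.B₀) (a b : Fin n) : C.V t a b = -C.V t b a :=
  congrFun (congrFun (C.V_transpose ht) b) a

/-- The unit vector is an eigenvector of `V` with eigenvalue `-d/2`. -/
theorem V_mulVec_unit (ht : t ∈ C.B₀) (a : Fin n) :
    ∑ b, C.V t a b * C.Psi t b 0 = -(M.d / 2) * C.Psi t a 0 := by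
  have h := congrFun (congrFun (C.V_mul_Psi ht) a) 0
  rw [Matrix.mul_apply, FrobeniusManifold.mu, Matrix.mul_diagonal, M.q_zero] at h
  rw [h]
  ring

end CanonicalCoordinates

/-! ### The recursion for the inverse of the R-matrix -/

section RMatrix

variable {n : ℕ}

/-- The Euler operator `z d/dz` on power series with matrix coefficients. -/
def eulerOp (f : PowerSeries (Matrix (Fin n) (Fin n) ℂ)) :
    PowerSeries (Matrix (Fin n) (Fin n) ℂ) :=
  PowerSeries.mk fun k => (k : ℂ) • PowerSeries.coeff k f

theorem eulerOp_mul (f g : PowerSeries (Matrix (Fin n) (Fin n) ℂ)) :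
    eulerOp (f * g) = eulerOp f * g + f * eulerOp g := by
  ext1 k
  simp only [eulerOp, map_add, PowerSeries.coeff_mul, PowerSeries.coeff_mk, Finset.smul_sum]
  rw [← Finset.sum_add_distrib]
  refine Finset.sum_congr rfl fun p hp => ?_
  rw [← Finset.HasAntidiagonal.mem_antidiagonal.1 hp, Matrix.smul_mul, Matrix.mul_smul, ← add_smul]
  push_cast
  rfl

theorem eulerOp_one : eulerOp (1 : PowerSeries (Matrix (Fin n) (Fin n) ℂ)) = 0 := by
  ext1 k
  rw [eulerOp, PowerSeries.coeff_mk, PowerSeries.coeff_one]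
  split_ifs with h <;> simp [h]

/-- If `R` satisfies `[U, R_{k+1}] = (k + V) R_k`, then `Q = R⁻¹` satisfies
`[U, Q_{k+1}] = Q_k (k - V)`. -/
theorem inverse_recursion {R Q : PowerSeries (Matrix (Fin n) (Fin n) ℂ)} (hRQ : R * Q = 1)
    (hQR : Q * R = 1) {U V : Matrix (Fin n) (Fin n) ℂ}
    (h0 : U * PowerSeries.coeff 0 R = PowerSeries.coeff 0 R * U)
    (h : ∀ k : ℕ, U * PowerSeries.coeff (k + 1) R - PowerSeries.coeff (k + 1) R * U
      = (k : ℂ) • PowerSeries.coeff k R + V * PowerSeries.coeff k R) (k : ℕ) :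
    U * PowerSeries.coeff (k + 1) Q - PowerSeries.coeff (k + 1) Q * U
      = (k : ℂ) • PowerSeries.coeff k Q - PowerSeries.coeff k Q * V := by
  have hR : PowerSeries.C U * R - R * PowerSeries.C U
      = PowerSeries.X * (eulerOp R + PowerSeries.C V * R) := by
    ext1 m
    rw [map_sub, PowerSeries.coeff_C_mul, PowerSeries.coeff_mul_C]
    cases m with
    | zero => rw [h0, sub_self, PowerSeries.coeff_zero_X_mul]
    | succ k =>
      rw [PowerSeries.coeff_succ_X_mul, map_add, PowerSeries.coeff_C_mul, h k, eulerOp,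
        PowerSeries.coeff_mk]
  have hθ : eulerOp Q = -(Q * eulerOp R * Q) := by
    have h1 : eulerOp Q * R + Q * eulerOp R = 0 := by rw [← eulerOp_mul, hQR, eulerOp_one]
    have h2 : eulerOp Q = eulerOp Q * R * Q := by rw [mul_assoc, hRQ, mul_one]
    rw [h2, eq_neg_of_add_eq_zero_left h1, neg_mul]
  have hQ : PowerSeries.C U * Q - Q * PowerSeries.C U
      = PowerSeries.X * (eulerOp Q - Q * PowerSeries.C V) := by
    have h1 : PowerSeries.C U * Q - Q * PowerSeries.C U
        = -(Q * (PowerSeries.C U * R - R * PowerSeries.C U) * Q) := by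
      rw [mul_sub, sub_mul, ← mul_assoc Q R, hQR, one_mul, ← mul_assoc Q, mul_assoc _ R, hRQ,
        mul_one, neg_sub]
    rw [h1, hR, hθ, ← mul_assoc Q, ← PowerSeries.X_mul, mul_assoc PowerSeries.X,
      mul_assoc PowerSeries.X, mul_add, add_mul, ← mul_assoc Q (PowerSeries.C V),
      mul_assoc _ R, hRQ, mul_one, ← mul_neg]
    congr 1
    abel
  have := congrArg (PowerSeries.coeff (k + 1)) hQ
  rw [map_sub, PowerSeries.coeff_C_mul, PowerSeries.coeff_mul_C, PowerSeries.coeff_succ_X_mul,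
    map_sub, PowerSeries.coeff_mul_C, eulerOp, PowerSeries.coeff_mk] at this
  exact this

theorem coeff_zero_invSeries (R : PowerSeries (Matrix (Fin n) (Fin n) ℂ)) :
    PowerSeries.coeff 0 (invSeries R) = 1 := by
  rw [invSeries, PowerSeries.coeff_zero_eq_constantCoeff_apply, PowerSeries.constantCoeff_invOfUnit]
  simp

end RMatrix

namespace CanonicalCoordinates.IsRMatrix

variable {n : ℕ} [NeZero n] {M : FrobeniusManifold n} {C : CanonicalCoordinates M}
  {R : (Fin n → ℂ) → PowerSeries (Matrix (Fin n) (Fin n) ℂ)}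
  {t : Fin n → ℂ}

/-- The `z`-component of flatness in the normalized canonical frame, where multiplication by the
Euler field is `U`. -/
theorem commutator (hR : C.IsRMatrix R) (ht : t ∈ C.B₀) (k : ℕ) :
    C.U t * PowerSeries.coeff (k + 1) (R t) - PowerSeries.coeff (k + 1) (R t) * C.U t
      = (k : ℂ) • PowerSeries.coeff k (R t) + C.V t * PowerSeries.coeff k (R t) := by
  have hP := C.isUnit_det_Psi ht
  have hU : C.Psi t * M.mulMatrix t (M.euler t) * (C.Psi t)⁻¹ = C.U t := by
    have h := hR.flat_z_lead t ht
    rw [hR.coeff_zero t ht, Matrix.mul_one, neg_add_eq_zero] at h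
    rw [Matrix.mul_assoc, ← h, ← Matrix.mul_assoc, Matrix.mul_nonsing_inv _ hP, Matrix.one_mul]
  have h := congrArg (C.Psi t * ·) (hR.flat_z t ht k)
  simp only [Matrix.mul_add, Matrix.mul_sub, Matrix.mul_smul, Matrix.mul_zero,
    ← Matrix.mul_assoc, Matrix.mul_nonsing_inv _ hP, Matrix.one_mul] at h
  rw [hU] at h
  rw [V, ← sub_eq_zero, ← h, neg_smul]
  abel

theorem mul_invSeries (hR : C.IsRMatrix R) (ht : t ∈ C.B₀) : R t * invSeries (R t) = 1 := by
  apply PowerSeries.mul_invOfUnit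
  rw [← PowerSeries.coeff_zero_eq_constantCoeff_apply, hR.coeff_zero t ht, Units.val_one]

theorem invSeries_mul (hR : C.IsRMatrix R) (ht : t ∈ C.B₀) : invSeries (R t) * R t = 1 := by
  have h1 := hR.mul_invSeries ht
  have h2 : invSeries (R t) * PowerSeries.invOfUnit (invSeries (R t)) 1 = 1 := by
    apply PowerSeries.mul_invOfUnit
    rw [← PowerSeries.coeff_zero_eq_constantCoeff_apply, coeff_zero_invSeries,
      Units.val_one]
  -- a right inverse which has a right inverse is two-sided
  have h3 : R t = PowerSeries.invOfUnit (invSeries (R t)) 1 := by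
    calc R t = R t * (invSeries (R t) * PowerSeries.invOfUnit (invSeries (R t)) 1) := by
          rw [h2, mul_one]
      _ = PowerSeries.invOfUnit (invSeries (R t)) 1 := by rw [← mul_assoc, h1, one_mul]
  rw [← h3] at h2
  exact h2

/-- The rows of `R⁻¹` satisfy `(u_i - u_a) q_{k+1, a} = k q_{k, a} + (V q_k)_a`. -/
theorem invSeries_row (hR : C.IsRMatrix R) (ht : t ∈ C.B₀) (i a : Fin n) (k : ℕ) :
    (C.u t i - C.u t a) * PowerSeries.coeff (k + 1) (invSeries (R t)) i a
      = (k : ℂ) * PowerSeries.coeff k (invSeries (R t)) i a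
        + ∑ b, C.V t a b * PowerSeries.coeff k (invSeries (R t)) i b := by
  have h := inverse_recursion (hR.mul_invSeries ht) (hR.invSeries_mul ht) (U := C.U t)
    (by rw [hR.coeff_zero t ht, Matrix.mul_one, Matrix.one_mul]) (hR.commutator ht) k
  have h2 := congrFun (congrFun h i) a
  rw [Matrix.sub_apply, Matrix.sub_apply, Matrix.smul_apply, U, Matrix.diagonal_mul,
    Matrix.mul_diagonal, Matrix.mul_apply, smul_eq_mul] at h2
  have h3 : ∑ b, C.V t a b * PowerSeries.coeff k (invSeries (R t)) i b
      = -∑ b, PowerSeries.coeff k (invSeries (R t)) i b * C.V t b a := by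
    rw [← Finset.sum_neg_distrib]
    refine Finset.sum_congr rfl fun b _ => ?_
    rw [C.V_apply_swap ht a b]
    ring
  rw [h3, ← sub_eq_add_neg, ← h2]
  ring

end CanonicalCoordinates.IsRMatrix

/-! ### Convergent power series in one variable -/

section PowerSeriesFunctions

/-- The sum `Σ_k c_k s^k`. -/
def pseries (c : ℕ → ℂ) (s : ℂ) : ℂ := ∑' k, c k * s ^ k

/-- The coefficients `c_k` are `O(r^{-k})`, so that `Σ_k c_k s^k` converges for `‖s‖ < r`. -/
def ConvergesAt (r : ℝ) (c : ℕ → ℂ) : Prop := ∃ K : ℝ, ∀ k, ‖c k‖ * r ^ k ≤ K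

variable {r : ℝ} {c : ℕ → ℂ} {s : ℂ}

theorem ConvergesAt.mul_bounded (hc : ConvergesAt r c) (hr : 0 ≤ r) {b : ℕ → ℂ} {K : ℝ}
    (hb : ∀ k, ‖b k‖ ≤ K) : ConvergesAt r fun k => b k * c k := by
  obtain ⟨A, hA⟩ := hc
  refine ⟨K * A, fun k => ?_⟩
  rw [norm_mul, mul_assoc]
  exact mul_le_mul (hb k) (hA k) (by positivity) ((norm_nonneg _).trans (hb k))

theorem ConvergesAt.const_mul (hc : ConvergesAt r c) (hr : 0 ≤ r) (b : ℂ) :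
    ConvergesAt r fun k => b * c k :=
  hc.mul_bounded hr (b := fun _ => b) fun _ => le_rfl

theorem natCast_add_half_ne_zero (k : ℕ) : (k : ℂ) + 1 / 2 ≠ 0 := by
  have : (0 : ℝ) < (k : ℝ) + 1 / 2 := by positivity
  have := Complex.ofReal_ne_zero.2 this.ne'
  push_cast at this
  exact this

theorem ConvergesAt.div_half (hc : ConvergesAt r c) (hr : 0 ≤ r) :
    ConvergesAt r fun k => c k / ((k : ℂ) + 1 / 2) := by
  have hb : ∀ k : ℕ, ‖((k : ℂ) + 1 / 2)⁻¹‖ ≤ 2 := by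
    intro k
    have h : ((k : ℂ) + 1 / 2) = (((k : ℝ) + 1 / 2 : ℝ) : ℂ) := by push_cast; rfl
    rw [norm_inv, h, Complex.norm_real, Real.norm_of_nonneg (by positivity)]
    rw [inv_le_comm₀ (by positivity) (by norm_num)]
    have : (0 : ℝ) ≤ k := Nat.cast_nonneg k
    linarith
  simpa only [div_eq_inv_mul] using hc.mul_bounded hr hb

theorem ConvergesAt.mono {r' : ℝ} (hc : ConvergesAt r c) (hr' : 0 ≤ r') (h : r' ≤ r) :
    ConvergesAt r' c := by
  obtain ⟨A, hA⟩ := hc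
  refine ⟨A, fun k => le_trans ?_ (hA k)⟩
  gcongr

theorem ConvergesAt.sum (hr : 0 ≤ r) {ι : Type*} (S : Finset ι) {c : ι → ℕ → ℂ}
    (hc : ∀ i ∈ S, ConvergesAt r (c i)) : ConvergesAt r fun k => ∑ i ∈ S, c i k := by
  choose! A hA using hc
  refine ⟨∑ i ∈ S, A i, fun k => ?_⟩
  refine (mul_le_mul_of_nonneg_right (norm_sum_le _ _) (by positivity)).trans ?_
  rw [Finset.sum_mul]
  exact Finset.sum_le_sum fun i hi => hA i hi k

theorem ConvergesAt.shift (hc : ConvergesAt r c) (hr : 0 < r) :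
    ConvergesAt r fun k => c (k + 1) := by
  obtain ⟨A, hA⟩ := hc
  refine ⟨A / r, fun k => ?_⟩
  rw [le_div_iff₀ hr, mul_assoc, ← pow_succ]
  exact hA (k + 1)

theorem ConvergesAt.unshift {c : ℕ → ℂ} (hc : ConvergesAt r fun k => c (k + 1)) (hr : 0 ≤ r) :
    ConvergesAt r c := by
  obtain ⟨A, hA⟩ := hc
  refine ⟨max ‖c 0‖ (A * r), fun k => ?_⟩
  cases k with
  | zero => simp
  | succ k =>
    rw [pow_succ, ← mul_assoc]
    exact (mul_le_mul_of_nonneg_right (hA k) hr).trans (le_max_right _ _)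

theorem summable_deriv_bound (r' : ℝ) (hr' : 0 ≤ r') (h : r' < r) (A : ℝ) :
    Summable fun k : ℕ => A / r * ((k + 1 : ℕ) * (r' / r) ^ k) := by
  apply Summable.mul_left
  have hr : 0 < r := hr'.trans_lt h
  have hq : ‖r' / r‖ < 1 := by
    rw [Real.norm_of_nonneg (by positivity), div_lt_one hr]
    exact h
  have h1 := summable_pow_mul_geometric_of_norm_lt_one 1 hq
  have h2 := summable_geometric_of_norm_lt_one hq
  refine (h1.add h2).congr fun k => ?_
  push_cast
  ring

theorem ConvergesAt.hasSum (hc : ConvergesAt r c) (hs : ‖s‖ < r) :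
    HasSum (fun k => c k * s ^ k) (pseries c s) := by
  obtain ⟨A, hA⟩ := hc
  have hr : 0 < r := (norm_nonneg s).trans_lt hs
  refine Summable.hasSum (Summable.of_norm_bounded (g := fun k => A * (‖s‖ / r) ^ k) ?_ ?_)
  · apply Summable.mul_left
    apply summable_geometric_of_lt_one (by positivity)
    rwa [div_lt_one hr]
  · intro k
    rw [norm_mul, norm_pow, div_pow, ← mul_div_assoc, le_div_iff₀ (by positivity)]
    calc ‖c k‖ * ‖s‖ ^ k * r ^ k = ‖c k‖ * r ^ k * ‖s‖ ^ k := by ring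
      _ ≤ A * ‖s‖ ^ k := mul_le_mul_of_nonneg_right (hA k) (by positivity)

/-- A bound on the terms of the derived series, uniform on `‖s‖ ≤ r'`. -/
theorem ConvergesAt.norm_deriv_coeff_le {A : ℝ} (hA : ∀ k, ‖c k‖ * r ^ k ≤ A) (hr : 0 < r)
    {r' : ℝ} (hs : ‖s‖ ≤ r') (k : ℕ) :
    ‖((k + 1 : ℕ) : ℂ) * c (k + 1) * s ^ k‖ ≤ A / r * ((k + 1 : ℕ) * (r' / r) ^ k) := by
  have h1 : ‖c (k + 1)‖ ≤ A / r ^ (k + 1) := by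
    rw [le_div_iff₀ (by positivity)]
    exact hA (k + 1)
  have hA0 : 0 ≤ A := (by positivity : (0 : ℝ) ≤ ‖c 0‖ * r ^ 0).trans (hA 0)
  rw [norm_mul, norm_mul, norm_pow, Complex.norm_natCast]
  calc ((k + 1 : ℕ) : ℝ) * ‖c (k + 1)‖ * ‖s‖ ^ k
      ≤ ((k + 1 : ℕ) : ℝ) * (A / r ^ (k + 1)) * r' ^ k := by gcongr
    _ = A / r * ((k + 1 : ℕ) * (r' / r) ^ k) := by
      rw [div_pow, pow_succ]
      field_simp

theorem ConvergesAt.hasSum_deriv (hc : ConvergesAt r c) (hs : ‖s‖ < r) :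
    HasSum (fun k => ((k + 1 : ℕ) : ℂ) * c (k + 1) * s ^ k)
      (pseries (fun k => ((k + 1 : ℕ) : ℂ) * c (k + 1)) s) := by
  obtain ⟨A, hA⟩ := hc
  exact Summable.hasSum (Summable.of_norm_bounded (summable_deriv_bound _ (norm_nonneg s) hs A)
    (ConvergesAt.norm_deriv_coeff_le hA ((norm_nonneg s).trans_lt hs) le_rfl))

theorem ConvergesAt.hasSum_mul_deriv (hc : ConvergesAt r c) (hs : ‖s‖ < r) :
    HasSum (fun k : ℕ => (k : ℂ) * c k * s ^ k)
      (s * pseries (fun k => ((k + 1 : ℕ) : ℂ) * c (k + 1)) s) := by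
  rw [← hasSum_nat_add_iff' 1]
  simp only [Finset.range_one, Finset.sum_singleton, Nat.cast_zero, zero_mul, sub_zero]
  refine ((hc.hasSum_deriv hs).mul_left s).congr_fun fun k => ?_
  ring

theorem ConvergesAt.half_add_mul_deriv (hc : ConvergesAt r c) (hs : ‖s‖ < r) :
    pseries c s / 2 + s * pseries (fun k => ((k + 1 : ℕ) : ℂ) * c (k + 1)) s
      = pseries (fun k => ((k : ℂ) + 1 / 2) * c k) s := by
  have h := ((hc.hasSum hs).div_const 2).add (hc.hasSum_mul_deriv hs)
  rw [← h.tsum_eq, pseries]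
  exact tsum_congr fun k => by ring

theorem pseries_zero (c : ℕ → ℂ) : pseries c 0 = c 0 := by
  rw [pseries, tsum_eq_single 0 (by simp +contextual)]
  simp

theorem ConvergesAt.eq_shift (hc : ConvergesAt r c) (hs : ‖s‖ < r) :
    pseries c s = c 0 + s * pseries (fun k => c (k + 1)) s := by
  have h1 := (hc.hasSum hs).summable.tsum_eq_zero_add
  rw [pseries, h1, pow_zero, mul_one, pseries, ← tsum_mul_left]
  congr 1
  exact tsum_congr fun k => by ring

theorem ConvergesAt.hasDerivAt (hc : ConvergesAt r c) (hs : ‖s‖ < r) :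
    HasDerivAt (pseries c) (pseries (fun k => ((k + 1 : ℕ) : ℂ) * c (k + 1)) s) s := by
  obtain ⟨r', h1, h2⟩ := exists_between hs
  have hr' : 0 ≤ r' := (norm_nonneg s).trans h1.le
  have hr : 0 < r := hr'.trans_lt h2
  obtain ⟨A, hA⟩ := id hc
  have key := hasDerivAt_tsum_of_isPreconnected
    (g := fun k s => c (k + 1) * s ^ (k + 1))
    (g' := fun k s => ((k + 1 : ℕ) : ℂ) * c (k + 1) * s ^ k)
    (t := Metric.ball (0 : ℂ) r') (y₀ := 0) (y := s)
    (summable_deriv_bound r' hr' h2 A) Metric.isOpen_ball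
    (convex_ball (0 : ℂ) r').isPreconnected
    (fun k y _ => by
      have := (hasDerivAt_pow (k + 1) y).const_mul (c (k + 1))
      simp only [add_tsub_cancel_right] at this
      convert! this using 1
      ring)
    (fun k y hy => ConvergesAt.norm_deriv_coeff_le hA hr (mem_ball_zero_iff.1 hy).le k)
    (by simpa using (norm_nonneg s).trans_lt h1)
    (by simp) (by simpa using h1)
  refine (key.const_add (c 0)).congr_of_eventuallyEq ?_
  have : ∀ᶠ y in 𝓝 s, ‖y‖ < r := (continuous_norm.tendsto s).eventually (gt_mem_nhds hs)
  filter_upwards [this] with y hy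
  rw [pseries, (hc.hasSum hy).summable.tsum_eq_zero_add]
  simp

theorem pseries_const_mul (b : ℂ) : pseries (fun k => b * c k) s = b * pseries c s := by
  rw [pseries, pseries, ← tsum_mul_left]
  exact tsum_congr fun k => by ring

theorem pseries_sum {ι : Type*} (S : Finset ι) {c : ι → ℕ → ℂ}
    (hc : ∀ i ∈ S, ConvergesAt r (c i)) (hs : ‖s‖ < r) :
    pseries (fun k => ∑ i ∈ S, c i k) s = ∑ i ∈ S, pseries (c i) s := by
  have h := hasSum_sum fun i hi => (hc i hi).hasSum hs
  rw [← h.tsum_eq, pseries]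
  exact tsum_congr fun k => by rw [Finset.sum_mul]

theorem ConvergesAt.analyticAt_zero (hc : ConvergesAt r c) (hr : 0 < r) :
    AnalyticAt ℂ (pseries c) 0 := by
  refine DifferentiableOn.analyticAt (s := Metric.ball 0 r) (fun s hs => ?_)
    (Metric.ball_mem_nhds _ hr)
  exact (hc.hasDerivAt (mem_ball_zero_iff.1 hs)).differentiableAt.differentiableWithinAt

end PowerSeriesFunctions

/-! ### Frobenius series at a finite singular point -/

section Frobenius

variable {n : ℕ} {u : Fin n → ℂ} {V : Matrix (Fin n) (Fin n) ℂ} {i : Fin n}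

/-- The recursion for the coefficients of a solution `Σ_k f_k (u_i - λ)^{k + ρ}` of the system
`(U - λ) f' = (1/2 + V) f`. -/
def IsFrobeniusSeries (u : Fin n → ℂ) (V : Matrix (Fin n) (Fin n) ℂ) (i : Fin n) (ρ : ℝ)
    (f : ℕ → Fin n → ℂ) : Prop :=
  ∀ (k : ℕ) (a : Fin n), (u i - u a) * ((k + 1 + ρ : ℝ) : ℂ) * f (k + 1) a
    = ((k + 1 / 2 + ρ : ℝ) : ℂ) * f k a + ∑ b, V a b * f k b

/-- The bound on `x_b` is only needed where `V a b` does not vanish. -/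
theorem norm_sum_mul_le (V : Matrix (Fin n) (Fin n) ℂ) (a : Fin n) {x : Fin n → ℂ} {B : ℝ}
    (hB : ∀ b, V a b ≠ 0 → ‖x b‖ ≤ B) (hB0 : 0 ≤ B) :
    ‖∑ b, V a b * x b‖ ≤ (∑ a, ∑ b, ‖V a b‖) * B := by
  calc ‖∑ b, V a b * x b‖ ≤ ∑ b, ‖V a b‖ * B := by
        refine (norm_sum_le _ _).trans (Finset.sum_le_sum fun b _ => ?_)
        rw [norm_mul]
        by_cases h : V a b = 0
        · simp [h]
        · exact mul_le_mul_of_nonneg_left (hB b h) (norm_nonneg _)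
    _ = (∑ b, ‖V a b‖) * B := (Finset.sum_mul ..).symm
    _ ≤ (∑ a, ∑ b, ‖V a b‖) * B := by
        refine mul_le_mul_of_nonneg_right ?_ hB0
        exact Finset.single_le_sum (f := fun a => ∑ b, ‖V a b‖)
          (fun a _ => Finset.sum_nonneg fun b _ => norm_nonneg _) (Finset.mem_univ a)

/-- Since the system is linear in `λ`, the recursion has two terms and its solutions grow at most
geometrically, at a rate that does not depend on the solution. -/
theorem exists_radius (hu : ∀ a, a ≠ i → u a ≠ u i) (hV : V i i = 0) :
    ∃ r : ℝ, 0 < r ∧ ∀ ρ : ℝ, -(1 / 2) ≤ ρ → ∀ f, IsFrobeniusSeries u V i ρ f →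
      ∀ a, ConvergesAt r fun k => f k a := by
  -- components `a ≠ i` are read off from the recursion at `k`, the component `i` from the recursion
  -- at `k + 1`, whose left-hand side vanishes
  set v : ℝ := ∑ a, ∑ b, ‖V a b‖ with hv
  have hv0 : 0 ≤ v := Finset.sum_nonneg fun a _ => Finset.sum_nonneg fun b _ => norm_nonneg _
  set κ : ℝ := ∑ a, ‖u i - u a‖⁻¹ with hκ
  have hκ0 : 0 ≤ κ := Finset.sum_nonneg fun a _ => inv_nonneg.2 (norm_nonneg _)
  set L₀ : ℝ := κ * (1 + 2 * v) with hL₀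
  have hL₀0 : 0 ≤ L₀ := by positivity
  set L : ℝ := (1 + v) * L₀ + 1 with hL
  have hLpos : 0 < L := by positivity
  refine ⟨L⁻¹, inv_pos.2 hLpos, fun ρ hρ f hf => ?_⟩
  have step : ∀ k, ‖f (k + 1)‖ ≤ L * ‖f k‖ := by
    intro k
    have hoff : ∀ a, a ≠ i → ‖f (k + 1) a‖ ≤ L₀ * ‖f k‖ := by
      intro a ha
      have hne : u i - u a ≠ 0 := sub_ne_zero.2 (hu a ha).symm
      have hp : (1 / 2 : ℝ) ≤ k + 1 + ρ := by
        have : (0 : ℝ) ≤ k := Nat.cast_nonneg k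
        linarith
      have hp0 : (0 : ℝ) < k + 1 + ρ := by linarith
      have h1 := congrArg norm (hf k a)
      rw [norm_mul, norm_mul, Complex.norm_real, Real.norm_of_nonneg hp0.le] at h1
      have h2 : ‖((k + 1 / 2 + ρ : ℝ) : ℂ) * f k a + ∑ b, V a b * f k b‖
          ≤ (k + 1 + ρ) * (1 + 2 * v) * ‖f k‖ := by
        refine (norm_add_le _ _).trans ?_
        have h3 : ‖((k + 1 / 2 + ρ : ℝ) : ℂ) * f k a‖ ≤ (k + 1 + ρ) * ‖f k‖ := by
          rw [norm_mul, Complex.norm_real, Real.norm_of_nonneg (by linarith)]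
          exact mul_le_mul (by linarith) (norm_le_pi_norm _ _) (norm_nonneg _) hp0.le
        have h4 : ‖∑ b, V a b * f k b‖ ≤ v * ‖f k‖ :=
          norm_sum_mul_le V a (fun b _ => norm_le_pi_norm _ _) (norm_nonneg _)
        have h5 : v * ‖f k‖ ≤ (k + 1 + ρ) * (2 * v) * ‖f k‖ := by
          refine mul_le_mul_of_nonneg_right ?_ (norm_nonneg _)
          nlinarith
        linarith
      rw [← h1] at h2
      have hn : 0 < ‖u i - u a‖ := norm_pos_iff.2 hne
      have h6 : ‖f (k + 1) a‖ ≤ ‖u i - u a‖⁻¹ * ((1 + 2 * v) * ‖f k‖) := by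
        rw [inv_mul_eq_div, le_div_iff₀ hn]
        refine le_of_mul_le_mul_left ?_ hp0
        linarith
      refine h6.trans ?_
      rw [hL₀, mul_assoc]
      refine mul_le_mul_of_nonneg_right ?_ (by positivity)
      exact Finset.single_le_sum (f := fun a => ‖u i - u a‖⁻¹)
        (fun a _ => inv_nonneg.2 (norm_nonneg _)) (Finset.mem_univ a)
    have hon : ‖f (k + 1) i‖ ≤ v * (L₀ * ‖f k‖) := by
      have h1 := hf (k + 1) i
      rw [sub_self, zero_mul, zero_mul, eq_comm, add_eq_zero_iff_eq_neg] at h1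
      have h2 := congrArg norm h1
      have hk : (0 : ℝ) ≤ k := Nat.cast_nonneg k
      have hp : (1 : ℝ) ≤ ((k + 1 : ℕ) : ℝ) + 1 / 2 + ρ := by push_cast; linarith
      rw [norm_mul, norm_neg, Complex.norm_real, Real.norm_of_nonneg (by linarith)] at h2
      have h3 : ‖∑ b, V i b * f (k + 1) b‖ ≤ v * (L₀ * ‖f k‖) :=
        norm_sum_mul_le V i (fun b hb => hoff b fun h => hb (h ▸ hV)) (by positivity)
      refine le_trans ?_ (h2.le.trans h3)
      exact le_mul_of_one_le_left (norm_nonneg _) hp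
    rw [pi_norm_le_iff_of_nonneg (by positivity)]
    have h0 : 0 ≤ L₀ * ‖f k‖ := by positivity
    have hf0 : 0 ≤ ‖f k‖ := norm_nonneg _
    intro a
    by_cases ha : a = i
    · subst ha
      refine hon.trans ?_
      rw [hL]
      linarith
    · refine (hoff a ha).trans ?_
      rw [hL]
      nlinarith [mul_nonneg hv0 h0]
  have bound : ∀ k, ‖f k‖ ≤ ‖f 0‖ * L ^ k := by
    intro k
    induction k with
    | zero => simp
    | succ k ih =>
      refine (step k).trans ?_
      rw [pow_succ]
      nlinarith
  intro a
  refine ⟨‖f 0‖, fun k => ?_⟩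
  rw [inv_pow, ← div_eq_mul_inv, div_le_iff₀ (by positivity)]
  exact (norm_le_pi_norm _ _).trans (bound k)

/-- The sum `F` of a Frobenius series satisfies
`(u_i - u_a - s)(s F_a' + ρ F_a) = s (F/2 + V F)_a`. -/
theorem IsFrobeniusSeries.ode {ρ : ℝ} {f : ℕ → Fin n → ℂ} (hf : IsFrobeniusSeries u V i ρ f)
    (h0 : ∀ a, (u i - u a) * ρ * f 0 a = 0) {r : ℝ} (hc : ∀ a, ConvergesAt r fun k => f k a)
    {s : ℂ} (hs : ‖s‖ < r) (a : Fin n) :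
    (u i - u a - s) * (s * pseries (fun k => ((k + 1 : ℕ) : ℂ) * f (k + 1) a) s
        + ρ * pseries (fun k => f k a) s)
      = s * (pseries (fun k => f k a) s / 2 + ∑ b, V a b * pseries (fun k => f k b) s) := by
  have hr : 0 < r := (norm_nonneg s).trans_lt hs
  set F := fun a => pseries (fun k => f k a) s with hF
  set D := pseries (fun k => ((k + 1 : ℕ) : ℂ) * f (k + 1) a) s with hD
  set S := pseries (fun k => f (k + 1) a) s with hS
  have e1 : F a = f 0 a + s * S := (hc a).eq_shift hs
  have e2 := ((((hc a).hasSum_deriv hs).add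
    ((((hc a).shift hr).hasSum hs).mul_left (ρ : ℂ))).mul_left (u i - u a))
  have e3 : HasSum (fun k : ℕ => (k : ℂ) * f k a * s ^ k) (s * D) := (hc a).hasSum_mul_deriv hs
  have e4 := (e3.add (((hc a).hasSum hs).mul_left ((1 / 2 + ρ : ℝ) : ℂ))).add
    (hasSum_sum (f := fun b k => V a b * (f k b * s ^ k)) (a := fun b => V a b * F b)
      fun b (_ : b ∈ Finset.univ) => ((hc b).hasSum hs).mul_left (V a b))
  have e5 : (u i - u a) * (D + ρ * S)
      = s * D + ((1 / 2 + ρ : ℝ) : ℂ) * F a + ∑ b, V a b * F b := by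
    refine e2.unique (e4.congr_fun fun k => ?_)
    have := hf k a
    have h6 : ∑ b, V a b * (f k b * s ^ k) = (∑ b, V a b * f k b) * s ^ k := by
      rw [Finset.sum_mul]
      exact Finset.sum_congr rfl fun b _ => by ring
    rw [h6]
    push_cast at this ⊢
    linear_combination s ^ k * this
  have e6 := h0 a
  change (u i - u a - s) * (s * D + ρ * F a) = s * (F a / 2 + ∑ b, V a b * F b)
  push_cast at e5
  linear_combination s * e5 + (u i - u a) * ρ * e1 + e6

/-- The holomorphic solutions at `u_i`: all the values `f_a(u_i)`, `a ≠ i`, may be prescribed. -/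
theorem exists_regular_series (hu : ∀ a, a ≠ i → u a ≠ u i) (hV : V i i = 0) (x : Fin n → ℂ) :
    ∃ f, IsFrobeniusSeries u V i 0 f ∧ ∀ a, a ≠ i → f 0 a = x a := by
  -- the component `i` of each coefficient is determined by the others
  let fill (k : ℕ) (y : Fin n → ℂ) : Fin n → ℂ := fun a =>
    if a = i then -(∑ b, if b = i then 0 else V i b * y b) / (k + 1 / 2) else y a
  let next (k : ℕ) (y : Fin n → ℂ) : Fin n → ℂ := fun a =>
    ((k + 1 / 2) * y a + ∑ b, V a b * y b) / ((u i - u a) * (k + 1))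
  let f : ℕ → Fin n → ℂ := fun k =>
    Nat.rec (fill 0 x) (fun k y => fill (k + 1) (next k y)) k
  have hfill : ∀ (k : ℕ) y, ((k : ℂ) + 1 / 2) * fill k y i + ∑ b, V i b * fill k y b = 0 := by
    intro k y
    have h1 : ∑ b, V i b * fill k y b = ∑ b, if b = i then 0 else V i b * y b := by
      refine Finset.sum_congr rfl fun b _ => ?_
      by_cases hb : b = i
      · simp [hb, hV]
      · simp [fill, hb]
    rw [h1]
    simp only [fill, if_true]
    rw [mul_div_cancel₀ _ (natCast_add_half_ne_zero k), neg_add_cancel]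
  have hf : ∀ k, ∃ y, f k = fill k y := by
    intro k
    cases k with
    | zero => exact ⟨x, rfl⟩
    | succ k => exact ⟨next k (f k), by simp [f]⟩
  refine ⟨f, fun k a => ?_, fun a ha => by simp [f, fill, ha]⟩
  by_cases ha : a = i
  · subst ha
    obtain ⟨y, hy⟩ := hf k
    rw [sub_self, zero_mul, zero_mul, hy]
    have := hfill k y
    push_cast
    rw [add_zero, this]
  · have h1 : f (k + 1) a = next k (f k) a := by simp [f, fill, ha]
    have hne : u i - u a ≠ 0 := sub_ne_zero.2 (hu a ha).symm
    have hk : (k : ℂ) + 1 ≠ 0 := Nat.cast_add_one_ne_zero k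
    rw [h1]
    simp only [next]
    push_cast
    rw [add_zero, add_zero, mul_div_cancel₀ _ (mul_ne_zero hne hk)]

end Frobenius

/-! ### Solutions of the Gauss-Manin system near a finite singular point -/

section LocalSolutions

variable {n : ℕ}

/-- `T` is a connected open part of the disc of radius `r` around `u_i`, with `u_i` on its boundary
and without singular points of the system, and `root` is a branch of `√(u_i - λ)` on `T`. -/
structure IsRootDomain (u : Fin n → ℂ) (i : Fin n) (r : ℝ) (T : Set ℂ) (root : ℂ → ℂ) : Prop where
  isOpen : IsOpen T
  isPreconnected : IsPreconnected T
  norm_lt : ∀ z ∈ T, ‖u i - z‖ < r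
  sub_ne_zero : ∀ z ∈ T, ∀ a, u a - z ≠ 0
  root_sq : ∀ z ∈ T, root z ^ 2 = u i - z
  continuousOn_root : ContinuousOn root T
  neBot : (𝓝[T] (u i)).NeBot

/-- `f` is a solution on `T` of the system `(U - λ) f' = (1/2 + V) f`. -/
def IsLocalSolution (u : Fin n → ℂ) (V : Matrix (Fin n) (Fin n) ℂ) (T : Set ℂ)
    (f : ℂ → Fin n → ℂ) : Prop :=
  ∀ z ∈ T, ∀ a, HasDerivAt (fun z => f z a) ((u a - z)⁻¹ * (f z a / 2 + ∑ b, V a b * f z b)) z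

/-- The bilinear form `fᵀ (U - λ) g`. -/
def uForm (u : Fin n → ℂ) (f g : ℂ → Fin n → ℂ) (z : ℂ) : ℂ :=
  ∑ a, f z a * (u a - z) * g z a

/-- The leading behaviour of a solution at `u_i`: the component `i` is `β_i / √(u_i - λ)` to leading
order, and the components `a ≠ i` tend to `β_a`. -/
structure HasLeadingVector (i : Fin n) (F : Filter ℂ) (root : ℂ → ℂ) (f : ℂ → Fin n → ℂ)
    (β : Fin n → ℂ) : Prop where
  diag : Tendsto (fun z => root z * f z i) F (𝓝 (β i))
  off : ∀ a, a ≠ i → Tendsto (fun z => f z a) F (𝓝 (β a))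

variable {u : Fin n → ℂ} {V : Matrix (Fin n) (Fin n) ℂ} {i : Fin n} {r : ℝ} {T : Set ℂ}
  {root : ℂ → ℂ}

theorem IsRootDomain.root_ne_zero (h : IsRootDomain u i r T root) {z : ℂ} (hz : z ∈ T) :
    root z ≠ 0 := by
  intro h0
  have := h.root_sq z hz
  rw [h0] at this
  exact h.sub_ne_zero z hz i (by simpa using this.symm)

theorem IsRootDomain.hasDerivAt_root (h : IsRootDomain u i r T root) {z : ℂ} (hz : z ∈ T) :
    HasDerivAt root (-(1 / (2 * root z))) z := by
  have hc : ContinuousAt root z := h.continuousOn_root.continuousAt (h.isOpen.mem_nhds hz)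
  have h0 := h.root_ne_zero hz
  have h1 : HasDerivAt (fun w : ℂ => u i - w ^ 2) (-(2 * root z)) (root z) := by
    simpa using (hasDerivAt_pow 2 (root z)).const_sub (u i)
  have h2 := HasDerivAt.of_local_left_inverse hc h1 (by simpa using h0)
    (Filter.mem_of_superset (h.isOpen.mem_nhds hz) fun y hy => by simp [h.root_sq y hy])
  convert! h2 using 1
  rw [inv_neg, one_div]

theorem IsRootDomain.tendsto_root (h : IsRootDomain u i r T root) :
    Tendsto root (𝓝[T] (u i)) (𝓝 0) := by
  have h1 : Tendsto (fun z => Real.sqrt ‖u i - z‖) (𝓝[T] (u i)) (𝓝 0) := by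
    have : Continuous fun z => Real.sqrt ‖u i - z‖ := by fun_prop
    have h2 := (this.tendsto (u i)).mono_left (nhdsWithin_le_nhds (s := T))
    simpa using h2
  refine tendsto_zero_iff_norm_tendsto_zero.2 (h1.congr' ?_)
  filter_upwards [self_mem_nhdsWithin] with z hz
  rw [← h.root_sq z hz, norm_pow, Real.sqrt_sq (norm_nonneg _)]

theorem ConvergesAt.tendsto_sub {c : ℕ → ℂ} (hc : ConvergesAt r c) (hr : 0 < r) (w : ℂ)
    (T : Set ℂ) : Tendsto (fun z => pseries c (w - z)) (𝓝[T] w) (𝓝 (c 0)) := by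
  have h1 : Tendsto (fun z : ℂ => w - z) (𝓝[T] w) (𝓝 0) := by
    have h2 : Continuous fun z : ℂ => w - z := by fun_prop
    simpa using (h2.tendsto w).mono_left (nhdsWithin_le_nhds (s := T))
  have h3 := (hc.analyticAt_zero hr).continuousAt.tendsto
  rw [pseries_zero] at h3
  exact h3.comp h1

theorem IsFrobeniusSeries.isLocalSolution_regular {f : ℕ → Fin n → ℂ}
    (hf : IsFrobeniusSeries u V i 0 f) (hc : ∀ a, ConvergesAt r fun k => f k a)
    (h : IsRootDomain u i r T root) :
    IsLocalSolution u V T fun z a => pseries (fun k => f k a) (u i - z) := by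
  intro z hz a
  have hs := h.norm_lt z hz
  have h1 := hf.ode (by simp) hc hs a
  have h2 := ((hc a).hasDerivAt hs).comp z ((hasDerivAt_id z).const_sub (u i))
  convert! h2 using 1
  have h3 := h.sub_ne_zero z hz i
  have h4 := h.sub_ne_zero z hz a
  rw [inv_mul_eq_div, div_eq_iff h4]
  apply mul_left_cancel₀ h3
  push_cast at h1 ⊢
  linear_combination -h1

theorem IsFrobeniusSeries.isLocalSolution_singular {f : ℕ → Fin n → ℂ}
    (hf : IsFrobeniusSeries u V i (-(1 / 2)) f) (h0 : ∀ a, a ≠ i → f 0 a = 0)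
    (hc : ∀ a, ConvergesAt r fun k => f k a) (h : IsRootDomain u i r T root) :
    IsLocalSolution u V T fun z a => (root z)⁻¹ * pseries (fun k => f k a) (u i - z) := by
  intro z hz a
  have hs := h.norm_lt z hz
  have h1 := hf.ode (fun a => by
    by_cases ha : a = i
    · simp [ha]
    · simp [h0 a ha]) hc hs a
  have hr0 := h.root_ne_zero hz
  have h2 := ((h.hasDerivAt_root hz).inv hr0).mul
    (((hc a).hasDerivAt hs).comp z ((hasDerivAt_id z).const_sub (u i)))
  convert! h2 using 1
  have h3 := h.root_sq z hz
  have h4 := h.sub_ne_zero z hz a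
  rw [← h3] at h1
  simp only [Function.comp_apply, Pi.inv_apply, ← h3]
  have h5 : ∑ b, V a b * ((root z)⁻¹ * pseries (fun k => f k b) (root z ^ 2))
      = (root z)⁻¹ * ∑ b, V a b * pseries (fun k => f k b) (root z ^ 2) := by
    rw [Finset.mul_sum]
    exact Finset.sum_congr rfl fun b _ => by ring
  have h6 : u i = z + root z ^ 2 := by rw [h3]; ring
  rw [h5, inv_mul_eq_div, div_eq_iff h4]
  rw [h6] at h1
  generalize pseries (fun k => f k a) (root z ^ 2) = F at *
  generalize pseries (fun k => ((k + 1 : ℕ) : ℂ) * f (k + 1) a) (root z ^ 2) = D at *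
  generalize ∑ b, V a b * pseries (fun k => f k b) (root z ^ 2) = W at *
  push_cast at h1
  field_simp
  linear_combination -2 * h1

theorem IsLocalSolution.sum_smul {f : Fin n → ℂ → Fin n → ℂ} (hf : ∀ j, IsLocalSolution u V T (f j))
    (c : Fin n → ℂ) :
    IsLocalSolution u V T fun z => ∑ j, c j • f j z := by
  intro z hz a
  have h1 := HasDerivAt.fun_sum fun j (_ : j ∈ Finset.univ) => (hf j z hz a).const_mul (c j)
  simp only [Finset.sum_apply, Pi.smul_apply, smul_eq_mul]
  convert! h1 using 1
  have h2 : ∀ j, c j * ((u a - z)⁻¹ * (f j z a / 2 + ∑ b, V a b * f j z b))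
      = (u a - z)⁻¹ * (c j * f j z a / 2 + ∑ b, V a b * (c j * f j z b)) := by
    intro j
    rw [mul_left_comm, mul_add, Finset.mul_sum, mul_div_assoc]
    congr 2
    exact Finset.sum_congr rfl fun b _ => by ring
  simp only [h2]
  rw [← Finset.mul_sum, Finset.sum_add_distrib, Finset.sum_div]
  congr 2
  simp only [Finset.mul_sum]
  exact Finset.sum_comm

/-- The form on two solutions has derivative `(V f)ᵀ g + fᵀ V g = 0`, as `V` is antisymmetric. -/
theorem IsLocalSolution.exists_uForm_eq (hV : ∀ a b, V a b = -V b a)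
    (h : IsRootDomain u i r T root) {f g : ℂ → Fin n → ℂ} (hf : IsLocalSolution u V T f)
    (hg : IsLocalSolution u V T g) : ∃ c, ∀ z ∈ T, uForm u f g z = c := by
  have hd : ∀ z ∈ T, HasDerivAt (uForm u f g) 0 z := by
    intro z hz
    have h1 := HasDerivAt.fun_sum fun a (_ : a ∈ Finset.univ) =>
      ((hf z hz a).mul ((hasDerivAt_id z).const_sub (u a))).mul (hg z hz a)
    convert! h1 using 1
    have h2 : ∀ a, ((u a - z)⁻¹ * (f z a / 2 + ∑ b, V a b * f z b) * (u a - id z) + f z a * -1)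
          * g z a
        + f z a * (u a - id z) * ((u a - z)⁻¹ * (g z a / 2 + ∑ b, V a b * g z b))
        = ∑ b, V a b * f z b * g z a + ∑ b, V a b * g z b * f z a := by
      intro a
      have := h.sub_ne_zero z hz a
      rw [← Finset.sum_mul, ← Finset.sum_mul, id]
      field_simp
      ring
    refine Eq.symm ((Finset.sum_congr rfl fun a _ => h2 a).trans ?_)
    rw [Finset.sum_add_distrib]
    conv_lhs => rw [add_comm, Finset.sum_comm, ← Finset.sum_add_distrib]
    refine Finset.sum_eq_zero fun a _ => ?_
    rw [← Finset.sum_add_distrib]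
    refine Finset.sum_eq_zero fun b _ => ?_
    rw [hV b a]
    ring
  exact h.isOpen.exists_is_const_of_deriv_eq_zero h.isPreconnected
    (fun z hz => (hd z hz).differentiableAt.differentiableWithinAt) fun z hz => (hd z hz).deriv

/-- The diagonal values of the form `fᵀ (U - λ) g` on leading vectors. -/
def leadingWeight (u : Fin n → ℂ) (i a : Fin n) : ℂ := if a = i then 1 else u a - u i

theorem HasLeadingVector.tendsto_uForm (h : IsRootDomain u i r T root) {f g : ℂ → Fin n → ℂ}
    {β β' : Fin n → ℂ} (hf : HasLeadingVector i (𝓝[T] (u i)) root f β)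
    (hg : HasLeadingVector i (𝓝[T] (u i)) root g β') :
    Tendsto (uForm u f g) (𝓝[T] (u i)) (𝓝 (∑ a, β a * leadingWeight u i a * β' a)) := by
  apply tendsto_finsetSum
  intro a _
  by_cases ha : a = i
  · subst ha
    have h1 := hf.diag.mul hg.diag
    rw [leadingWeight, if_pos rfl, mul_one]
    refine h1.congr' ?_
    filter_upwards [self_mem_nhdsWithin] with z hz
    rw [← h.root_sq z hz]
    ring
  · rw [leadingWeight, if_neg ha]
    have h1 : Continuous fun z => u a - z := by fun_prop
    exact ((hf.off a ha).mul ((h1.tendsto (u i)).mono_left nhdsWithin_le_nhds)).mul (hg.off a ha)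

/-- The form on two solutions is constant, hence equal to its value on the leading vectors. -/
theorem HasLeadingVector.uForm_eq (hV : ∀ a b, V a b = -V b a) (h : IsRootDomain u i r T root)
    {f g : ℂ → Fin n → ℂ} (hf : IsLocalSolution u V T f) (hg : IsLocalSolution u V T g)
    {β β' : Fin n → ℂ} (hβ : HasLeadingVector i (𝓝[T] (u i)) root f β)
    (hβ' : HasLeadingVector i (𝓝[T] (u i)) root g β') {z : ℂ} (hz : z ∈ T) :
    uForm u f g z = ∑ a, β a * leadingWeight u i a * β' a := by
  obtain ⟨c, hc⟩ := hf.exists_uForm_eq hV h hg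
  have := h.neBot
  have h1 : Tendsto (uForm u f g) (𝓝[T] (u i)) (𝓝 c) := by
    refine tendsto_const_nhds.congr' ?_
    filter_upwards [self_mem_nhdsWithin] with y hy
    exact (hc y hy).symm
  rw [hc z hz]
  exact tendsto_nhds_unique h1 (hβ.tendsto_uForm h hβ')

theorem leadingWeight_ne_zero (hu : ∀ a, a ≠ i → u a ≠ u i) (a : Fin n) :
    leadingWeight u i a ≠ 0 := by
  rw [leadingWeight]
  split_ifs with ha
  · exact one_ne_zero
  · exact sub_ne_zero.2 (hu a ha)

/-- Solutions whose leading vectors are the standard basis form a basis of all solutions; the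
coefficients are read off from the invariant form. -/
theorem IsLocalSolution.eq_sum (hu : ∀ a, a ≠ i → u a ≠ u i) (hV : ∀ a b, V a b = -V b a)
    (h : IsRootDomain u i r T root) {Φ : Fin n → ℂ → Fin n → ℂ}
    (hΦ : ∀ l, IsLocalSolution u V T (Φ l))
    (hβ : ∀ l, HasLeadingVector i (𝓝[T] (u i)) root (Φ l) (Pi.single l 1)) {f : ℂ → Fin n → ℂ}
    {z : ℂ} (hz : z ∈ T) :
    f z = ∑ l, (uForm u (Φ l) f z / leadingWeight u i l) • Φ l z := by
  -- `A Q = 1` expresses that the basis is orthogonal for the form; then `Q A = 1`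
  let A : Matrix (Fin n) (Fin n) ℂ := Matrix.of fun l a => Φ l z a * (u a - z)
  let Q : Matrix (Fin n) (Fin n) ℂ := Matrix.of fun a l => Φ l z a / leadingWeight u i l
  have hAQ : A * Q = 1 := by
    ext l m
    have h1 := (hβ l).uForm_eq hV h (hΦ l) (hΦ m) (hβ m) hz
    rw [Matrix.mul_apply, Matrix.one_apply]
    have h2 : ∑ a, A l a * Q a m = uForm u (Φ l) (Φ m) z / leadingWeight u i m := by
      rw [uForm, Finset.sum_div]
      exact Finset.sum_congr rfl fun a _ => by simp only [A, Q, Matrix.of_apply]; ring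
    rw [h2, h1, Finset.sum_eq_single l (by simp +contextual [Pi.single_apply]) (by simp)]
    by_cases hlm : l = m
    · subst hlm
      simp [leadingWeight_ne_zero hu]
    · simp [hlm]
  have hQA : Q * A = 1 := mul_eq_one_comm.1 hAQ
  have h3 : f z = Q *ᵥ (A *ᵥ f z) := by rw [Matrix.mulVec_mulVec, hQA, Matrix.one_mulVec]
  rw [h3]
  funext a
  simp only [Matrix.mulVec, dotProduct, Finset.sum_apply, Pi.smul_apply, smul_eq_mul, uForm, A, Q,
    Matrix.of_apply]
  refine Finset.sum_congr rfl fun l _ => ?_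
  ring

theorem hasLeadingVector_regular {f : ℕ → Fin n → ℂ} (hr : 0 < r)
    (hc : ∀ a, ConvergesAt r fun k => f k a) (h : IsRootDomain u i r T root) {l : Fin n}
    (hl : l ≠ i) (h0 : ∀ a, a ≠ i → f 0 a = (Pi.single l 1 : Fin n → ℂ) a) :
    HasLeadingVector i (𝓝[T] (u i)) root (fun z a => pseries (fun k => f k a) (u i - z))
      (Pi.single l 1) where
  diag := by
    have := h.tendsto_root.mul ((hc i).tendsto_sub hr (u i) T)
    simpa [Pi.single_apply, hl.symm] using this
  off a ha := by
    rw [← h0 a ha]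
    exact (hc a).tendsto_sub hr (u i) T

theorem hasLeadingVector_singular {f : ℕ → Fin n → ℂ} (hr : 0 < r)
    (hc : ∀ a, ConvergesAt r fun k => f k a) (h : IsRootDomain u i r T root)
    (h0 : f 0 = Pi.single i 1) :
    HasLeadingVector i (𝓝[T] (u i)) root
      (fun z a => (root z)⁻¹ * pseries (fun k => f k a) (u i - z)) (Pi.single i 1) where
  diag := by
    have h1 := (hc i).tendsto_sub hr (u i) T
    rw [h0] at h1
    refine h1.congr' ?_
    filter_upwards [self_mem_nhdsWithin] with z hz
    rw [mul_inv_cancel_left₀ (h.root_ne_zero hz)]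
  off a ha := by
    have h1 := h.tendsto_root.mul (((hc a).shift hr).tendsto_sub hr (u i) T)
    rw [zero_mul] at h1
    rw [Pi.single_eq_of_ne ha]
    refine h1.congr' ?_
    filter_upwards [self_mem_nhdsWithin] with z hz
    rw [(hc a).eq_shift (h.norm_lt z hz), h0, Pi.single_eq_of_ne ha, zero_add, ← h.root_sq z hz]
    have := h.root_ne_zero hz
    field_simp

/-- A solution `f` with `(φ^(i))ᵀ (U - λ) f = 1`, where `φ^(i)` is the solution with leading vector
`e_i`, differs from `φ^(i)`, and hence from the singular Frobenius series, by a solution which is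
holomorphic at `u_i`. -/
theorem IsLocalSolution.eq_singular_add_regular (hu : ∀ a, a ≠ i → u a ≠ u i)
    (hV : ∀ a b, V a b = -V b a) (hr : 0 < r)
    (hrad : ∀ ρ : ℝ, -(1 / 2) ≤ ρ → ∀ f, IsFrobeniusSeries u V i ρ f →
      ∀ a, ConvergesAt r fun k => f k a)
    (h : IsRootDomain u i r T root) {χ : ℕ → Fin n → ℂ}
    (hχ : IsFrobeniusSeries u V i (-(1 / 2)) χ) (hχ0 : χ 0 = Pi.single i 1)
    {φ f : ℂ → Fin n → ℂ} (hφ : IsLocalSolution u V T φ)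
    (hφβ : HasLeadingVector i (𝓝[T] (u i)) root φ (Pi.single i 1))
    (hf : IsLocalSolution u V T f) (hφf : ∀ z ∈ T, uForm u φ f z = 1) :
    ∃ g : ℕ → Fin n → ℂ, (∀ a, ConvergesAt r fun k => g k a) ∧ ∀ z ∈ T, ∀ a,
      f z a = (root z)⁻¹ * pseries (fun k => χ k a) (u i - z)
        + pseries (fun k => g k a) (u i - z) := by
  have hVi : V i i = 0 := by linear_combination (1 / 2 : ℂ) * hV i i
  choose e he he0 using fun l : Fin n => exists_regular_series hu hVi (Pi.single l 1)
  have hce := fun l => hrad 0 (by norm_num) (e l) (he l)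
  have hcχ := hrad _ le_rfl χ hχ
  set Φs : ℂ → Fin n → ℂ := fun z a => (root z)⁻¹ * pseries (fun k => χ k a) (u i - z) with hΦs
  set Φr : Fin n → ℂ → Fin n → ℂ := fun l z a => pseries (fun k => e l k a) (u i - z) with hΦr
  set Φ : Fin n → ℂ → Fin n → ℂ := fun l => if l = i then Φs else Φr l with hΦdef
  have hΦ : ∀ l, IsLocalSolution u V T (Φ l) := by
    intro l
    by_cases hl : l = i
    · simp only [hΦdef, hl, if_true]
      exact hχ.isLocalSolution_singular (fun a ha => by rw [hχ0, Pi.single_eq_of_ne ha]) hcχ h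
    · simp only [hΦdef, hl, if_false]
      exact (he l).isLocalSolution_regular (hce l) h
  have hβ : ∀ l, HasLeadingVector i (𝓝[T] (u i)) root (Φ l) (Pi.single l 1) := by
    intro l
    by_cases hl : l = i
    · subst hl
      simp only [hΦdef, if_true]
      exact hasLeadingVector_singular hr hcχ h hχ0
    · simp only [hΦdef, hl, if_false]
      exact hasLeadingVector_regular hr (hce l) h hl (he0 l)
  have hw : leadingWeight u i i = 1 := if_pos rfl
  -- `φ` is the singular solution, since its leading vector is `e_i`
  have hφΦ : ∀ z ∈ T, φ z = Φ i z := by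
    intro z hz
    rw [IsLocalSolution.eq_sum hu hV h hΦ hβ hz (f := φ), Finset.sum_eq_single i]
    · rw [(hβ i).uForm_eq hV h (hΦ i) hφ hφβ hz,
        Finset.sum_eq_single i (by simp +contextual) (by simp)]
      simp [hw]
    · intro l _ hl
      rw [(hβ l).uForm_eq hV h (hΦ l) hφ hφβ hz, Finset.sum_eq_zero, zero_div, zero_smul]
      intro a _
      by_cases ha : a = i
      · subst ha
        simp [Pi.single_eq_of_ne hl.symm]
      · simp [Pi.single_eq_of_ne ha]
    · simp
  -- the coefficient of the singular solution in `f` is `(φ^(i))ᵀ (U - λ) f = 1`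
  choose c hc using fun l => (hΦ l).exists_uForm_eq hV h hf
  refine ⟨fun k a => ∑ l ∈ Finset.univ.erase i, c l / leadingWeight u i l * e l k a,
    fun a => ConvergesAt.sum hr.le _ fun l _ => (hce l a).const_mul hr.le _, fun z hz a => ?_⟩
  have h1 := congrFun (IsLocalSolution.eq_sum hu hV h hΦ hβ hz (f := f)) a
  have hi : uForm u (Φ i) f z = 1 := by
    rw [← hφf z hz, uForm, uForm, hφΦ z hz]
  rw [← Finset.add_sum_erase _ _ (Finset.mem_univ i), Pi.add_apply, hi, hw, div_one, one_smul] at h1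
  rw [h1]
  congr 1
  · simp [hΦdef, hΦs]
  · rw [pseries_sum _ (fun l _ => (hce l a).const_mul hr.le _) (h.norm_lt z hz), Finset.sum_apply]
    refine Finset.sum_congr rfl fun l hl => ?_
    rw [pseries_const_mul, Pi.smul_apply, smul_eq_mul, hc l z hz]
    simp [hΦdef, hΦr, Finset.ne_of_mem_erase hl]

end LocalSolutions

/-! ### The cut plane near a branch point -/

section CutPlane

theorem mem_ray_iff {a ν z : ℂ} (hν : ν ≠ 0) :
    z ∈ ray a ν ↔ 0 ≤ ((z - a) / ν).re ∧ ((z - a) / ν).im = 0 := by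
  constructor
  · rintro ⟨s, hs, rfl⟩
    rw [add_sub_cancel_left, mul_div_cancel_right₀ _ hν]
    exact ⟨hs, Complex.ofReal_im s⟩
  · rintro ⟨h1, h2⟩
    refine ⟨((z - a) / ν).re, h1, ?_⟩
    have : (((z - a) / ν).re : ℂ) = (z - a) / ν := Complex.ext rfl h2.symm
    rw [this, div_mul_cancel₀ _ hν]
    ring

theorem isClosed_ray {ν : ℂ} (hν : ν ≠ 0) (a : ℂ) : IsClosed (ray a ν) := by
  have h : ray a ν = {z | 0 ≤ ((z - a) / ν).re} ∩ {z | ((z - a) / ν).im = 0} :=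
    Set.ext fun z => mem_ray_iff hν
  rw [h]
  exact (isClosed_le continuous_const (by fun_prop)).inter
    (isClosed_eq (by fun_prop) continuous_const)

theorem isOpen_slitPlane {n : ℕ} {ν : ℂ} (hν : ν ≠ 0) (a : Fin n → ℂ) :
    IsOpen (slitPlane a ν) :=
  (isClosed_iUnion_of_finite fun i => isClosed_ray hν (a i)).isOpen_compl

theorem ne_of_mem_slitPlane {n : ℕ} {ν z : ℂ} {a : Fin n → ℂ} (hz : z ∈ slitPlane a ν)
    (i : Fin n) : a i - z ≠ 0 := by
  intro h
  exact hz (Set.mem_iUnion.2 ⟨i, 0, le_rfl, by simp [sub_eq_zero.1 h]⟩)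

theorem sub_mul_notMem_ray {ν : ℂ} (hν : ν ≠ 0) (a : ℂ) {ε : ℝ} (hε : 0 < ε) :
    a - ε * ν ∉ ray a ν := by
  rw [mem_ray_iff hν]
  rintro ⟨h1, _⟩
  have : (a - ε * ν - a) / ν = -(ε : ℂ) := by
    field_simp
    ring
  rw [this, Complex.neg_re, Complex.ofReal_re] at h1
  linarith

/-- A disc around the end point of a cut is star-shaped, without the cut, with respect to points on
the opposite ray. -/
theorem isPreconnected_ball_diff_ray {ν : ℂ} (hν : ν ≠ 0) (a : ℂ) {r : ℝ} (hr : 0 < r) :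
    IsPreconnected (Metric.ball a r \ ray a ν) := by
  have hν0 : 0 < ‖ν‖ := norm_pos_iff.2 hν
  set ε : ℝ := r / (2 * ‖ν‖) with hε
  have hε0 : 0 < ε := by positivity
  have hmem : a - ε * ν ∈ Metric.ball a r := by
    rw [mem_ball_iff_norm, sub_sub_cancel_left, norm_neg, norm_mul, Complex.norm_real,
      Real.norm_of_nonneg hε0.le, hε]
    field_simp
    linarith
  have hstar : StarConvex ℝ (a - ε * ν) (Metric.ball a r \ ray a ν) := by
    intro z hz x y hx hy hxy
    refine ⟨(convex_ball a r) hmem hz.1 hx hy hxy, fun hray => ?_⟩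
    obtain ⟨h1, h2⟩ := (mem_ray_iff hν).1 hray
    have key : (x • (a - ε * ν) + y • z - a) / ν = -((x * ε : ℝ) : ℂ) + y * ((z - a) / ν) := by
      have hxy' : (x : ℂ) = 1 - y := by exact_mod_cast eq_sub_of_add_eq hxy
      simp only [Complex.real_smul]
      push_cast
      rw [hxy']
      field_simp
      ring
    rw [key] at h1 h2
    simp only [Complex.add_re, Complex.neg_re, Complex.ofReal_re, Complex.re_ofReal_mul] at h1
    simp only [Complex.add_im, Complex.neg_im, Complex.ofReal_im, Complex.im_ofReal_mul, neg_zero,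
      zero_add] at h2
    have hy0 : 0 < y := by
      rcases hy.eq_or_lt with h | h
      · rw [← h] at h1 hxy
        rw [add_zero] at hxy
        rw [hxy] at h1
        linarith
      · exact h
    refine hz.2 ((mem_ray_iff hν).2 ⟨?_, (mul_eq_zero.1 h2).resolve_left hy0.ne'⟩)
    have h3 : 0 ≤ x * ε := mul_nonneg hx hε0.le
    by_contra hneg
    nlinarith [mul_neg_of_pos_of_neg hy0 (not_le.1 hneg)]
  exact (hstar.isPathConnected ⟨hmem, sub_mul_notMem_ray hν a hε0⟩).isConnected.isPreconnected

variable {n : ℕ} [NeZero n] {M : FrobeniusManifold n} {C : CanonicalCoordinates M}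

theorem Cuts.u_ne (K : Cuts C) {t : Fin n → ℂ} (ht : t ∈ C.B₀) {i a : Fin n} (ha : a ≠ i) :
    C.u t a ≠ C.u t i :=
  fun h => K.not_mem_ray t ht i a ha.symm ⟨0, le_rfl, by simp [h]⟩

theorem Cuts.eventually_notMem_ray (K : Cuts C) {t : Fin n → ℂ} (ht : t ∈ C.B₀) (i : Fin n) :
    ∀ᶠ z in 𝓝 (C.u t i), ∀ j, j ≠ i → z ∉ ray (C.u t j) K.ν := by
  refine Filter.eventually_all.2 fun j => ?_
  by_cases hj : j = i
  · simp [hj]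
  · filter_upwards [(isClosed_ray K.ν_ne_zero (C.u t j)).isOpen_compl.mem_nhds
      (K.not_mem_ray t ht j i hj)] with z hz _
    exact hz

theorem Cuts.neBot (K : Cuts C) {t : Fin n → ℂ} (ht : t ∈ C.B₀) (i : Fin n) :
    (𝓝[slitPlane (C.u t) K.ν] (C.u t i)).NeBot := by
  have h1 : Tendsto (fun ε : ℝ => C.u t i - ε * K.ν) (𝓝[>] 0) (𝓝 (C.u t i)) := by
    have hc : Continuous fun ε : ℝ => C.u t i - ε * K.ν := by fun_prop
    simpa using (hc.tendsto 0).mono_left (nhdsWithin_le_nhds (s := Set.Ioi (0 : ℝ)))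
  have h2 := K.eventually_notMem_ray ht i
  have h3 : ∀ᶠ ε : ℝ in 𝓝[>] 0, C.u t i - ε * K.ν ∈ slitPlane (C.u t) K.ν := by
    filter_upwards [h1.eventually h2, self_mem_nhdsWithin] with ε hε hpos
    intro hmem
    obtain ⟨j, hj⟩ := Set.mem_iUnion.1 hmem
    by_cases hji : j = i
    · subst hji
      exact sub_mul_notMem_ray K.ν_ne_zero _ hpos hj
    · exact hε j hji hj
  exact (tendsto_nhdsWithin_iff.2 ⟨h1, h3⟩).neBot

/-- Small discs around `u_i`, without the cuts, meet no cut but `L_i`. -/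
theorem Cuts.exists_isRootDomain (K : Cuts C) {t : Fin n → ℂ} (ht : t ∈ C.B₀) (i : Fin n) :
    ∃ δ : ℝ, 0 < δ ∧ ∀ r : ℝ, 0 < r → r ≤ δ →
      IsRootDomain (C.u t) i r (Metric.ball (C.u t i) r ∩ slitPlane (C.u t) K.ν)
        (fun z => K.root i (z, t)) := by
  have h2 := K.eventually_notMem_ray ht i
  obtain ⟨δ, hδ, hball⟩ := Metric.eventually_nhds_iff_ball.1 h2
  refine ⟨δ, hδ, fun r hr hrδ => ?_⟩
  have heq : Metric.ball (C.u t i) r ∩ slitPlane (C.u t) K.ν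
      = Metric.ball (C.u t i) r \ ray (C.u t i) K.ν := by
    ext z
    refine and_congr_right fun hz => ⟨fun h hmem => h (Set.mem_iUnion.2 ⟨i, hmem⟩),
      fun h hmem => ?_⟩
    obtain ⟨j, hj⟩ := Set.mem_iUnion.1 hmem
    by_cases hji : j = i
    · subst hji
      exact h hj
    · exact hball z (Metric.ball_subset_ball hrδ hz) j hji hj
  refine ⟨Metric.isOpen_ball.inter (isOpen_slitPlane K.ν_ne_zero _), ?_, ?_, ?_, ?_, ?_, ?_⟩
  · rw [heq]
    exact isPreconnected_ball_diff_ray K.ν_ne_zero _ hr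
  · intro z hz
    rw [norm_sub_rev]
    exact mem_ball_iff_norm.1 hz.1
  · exact fun z hz => ne_of_mem_slitPlane hz.2
  · exact fun z hz => K.root_sq i (z, t) ht hz.2
  · exact (K.continuousOn_root i).comp (f := fun z : ℂ => (z, t)) (by fun_prop)
      fun z hz => ⟨ht, hz.2⟩
  · have := K.neBot ht i
    rw [nhdsWithin_inter_of_mem (mem_nhdsWithin_of_mem_nhds (Metric.ball_mem_nhds _ hr))]
    exact this

end CutPlane

/-! ### The superpotential near a branch point -/

section Superpotential

variable {n : ℕ} [NeZero n] {M : FrobeniusManifold n} {C : CanonicalCoordinates M} {K : Cuts C}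

theorem IsGaussManinSolution.isLocalSolution {f : ℂ × (Fin n → ℂ) → Fin n → ℂ}
    (hf : IsGaussManinSolution K f) {t : Fin n → ℂ} (ht : t ∈ C.B₀) {T : Set ℂ}
    (hT : T ⊆ slitPlane (C.u t) K.ν) :
    IsLocalSolution (C.u t) (C.V t) T fun z => f (z, t) := by
  intro z hz a
  obtain ⟨h1, h2⟩ := hf (z, t) ⟨ht, hT hz⟩
  have h3 : HasDerivAt (fun w : ℂ => (w, t)) ((1 : ℂ), (0 : Fin n → ℂ)) z :=
    (hasDerivAt_id z).prodMk (hasDerivAt_const z t)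
  have h4 := h1.hasFDerivAt.comp_hasDerivAt z h3
  have h5 := hasDerivAt_pi.1 h4 a
  convert! h5 using 1
  have hU : C.dU t 0 = 0 := by
    simp [CanonicalCoordinates.dU]
  have hP : C.dPsi t 0 = 0 := by
    ext
    simp [CanonicalCoordinates.dPsi]
  rw [h2]
  simp only [hU, hP, zero_sub, mul_neg, neg_mul, neg_neg, zero_mul, Matrix.zero_mulVec, add_zero,
    Matrix.diagonal_one, mul_one, ← Matrix.mulVec_mulVec, Matrix.mulVec_diagonal,
    Matrix.add_mulVec, Pi.add_apply, Pi.zero_apply]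
  rw [Matrix.mulVec, dotProduct]
  ring

variable {r : ℝ} {t : Fin n → ℂ} {i : Fin n}

theorem SuperpotentialData.isLocalSolution_phi (S : SuperpotentialData K) (ht : t ∈ C.B₀)
    {T : Set ℂ} (hT : T ⊆ slitPlane (C.u t) K.ν) :
    IsLocalSolution (C.u t) (C.V t) T fun z => S.phi (z, t) :=
  IsLocalSolution.sum_smul
    (fun j => (S.isDubrovinSystem.solution j).isLocalSolution ht hT) S.γ

theorem SuperpotentialData.hasLeadingVector (S : SuperpotentialData K) (ht : t ∈ C.B₀)
    {T : Set ℂ} (hT : T ⊆ slitPlane (C.u t) K.ν)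
    (h : IsRootDomain (C.u t) i r T fun z => K.root i (z, t)) :
    HasLeadingVector i (𝓝[T] (C.u t i)) (fun z => K.root i (z, t)) (fun z => S.φ i (z, t))
      (Pi.single i 1) where
  diag := by
    have h1 := ((S.isDubrovinSystem.asymp_diag t ht i).mono (nhdsWithin_mono _ hT)).trans_tendsto
      h.tendsto_root
    have h2 := (h.tendsto_root.mul h1).add_const 1
    rw [zero_mul, zero_add] at h2
    rw [Pi.single_eq_same]
    refine h2.congr' ?_
    filter_upwards [self_mem_nhdsWithin] with z hz
    have := h.root_ne_zero hz
    field_simp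
    ring
  off a ha := by
    rw [Pi.single_eq_of_ne ha]
    exact ((S.isDubrovinSystem.asymp_off t ht i a ha).mono (nhdsWithin_mono _ hT)).trans_tendsto
      h.tendsto_root

theorem SuperpotentialData.uForm_phi (S : SuperpotentialData K) (ht : t ∈ C.B₀) {z : ℂ}
    (hz : z ∈ slitPlane (C.u t) K.ν) (i : Fin n) :
    uForm (C.u t) (fun z => S.φ i (z, t)) (fun z => S.phi (z, t)) z = 1 := by
  rw [← S.G_mul_γ i, uForm]
  simp only [S.G_eq (z, t) ⟨ht, hz⟩, SuperpotentialData.phi, Finset.sum_apply, Pi.smul_apply,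
    smul_eq_mul, Finset.sum_mul, Finset.mul_sum]
  rw [Finset.sum_comm]
  exact Finset.sum_congr rfl fun j _ => Finset.sum_congr rfl fun a _ => by ring

/-- Since `V` is antisymmetric and the unit vector is an eigenvector of `V`, the derivative of the
superpotential is `-(1/√2) φᵀ Ψ 𝟙`. -/
theorem SuperpotentialData.hasDerivAt_P (S : SuperpotentialData K) (hd : M.d ≠ 1) (ht : t ∈ C.B₀)
    {z : ℂ} (hz : z ∈ slitPlane (C.u t) K.ν) :
    HasDerivAt (fun z => S.P (z, t))
      (-((Real.sqrt 2 : ℂ) / 2) * ∑ a, S.phi (z, t) a * C.Psi t a 0) z := by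
  have hf := S.isLocalSolution_phi ht (T := slitPlane (C.u t) K.ν) subset_rfl z hz
  have h1 := (HasDerivAt.fun_sum fun a (_ : a ∈ Finset.univ) =>
    ((hf a).mul ((hasDerivAt_id z).const_sub (C.u t a))).mul_const (C.Psi t a 0)).const_mul
      ((Real.sqrt 2 : ℂ) / (1 - M.d))
  convert! h1 using 1
  have hne := fun a => ne_of_mem_slitPlane hz a
  have h2 : ∀ a, ((C.u t a - z)⁻¹ * (S.phi (z, t) a / 2 + ∑ b, C.V t a b * S.phi (z, t) b)
        * (C.u t a - id z) + S.phi (z, t) a * -1) * C.Psi t a 0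
      = -(1 / 2) * (S.phi (z, t) a * C.Psi t a 0)
        + ∑ b, C.V t a b * S.phi (z, t) b * C.Psi t a 0 := by
    intro a
    have := hne a
    rw [← Finset.sum_mul, id]
    field_simp
    ring
  rw [Finset.sum_congr rfl fun a _ => h2 a, Finset.sum_add_distrib, ← Finset.mul_sum,
    Finset.sum_comm]
  have h3 : ∀ b, ∑ a, C.V t a b * S.phi (z, t) b * C.Psi t a 0
      = M.d / 2 * (S.phi (z, t) b * C.Psi t b 0) := by
    intro b
    have h4 := C.V_mulVec_unit ht b
    calc ∑ a, C.V t a b * S.phi (z, t) b * C.Psi t a 0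
        = -S.phi (z, t) b * ∑ a, C.V t b a * C.Psi t a 0 := by
          rw [Finset.mul_sum]
          refine Finset.sum_congr rfl fun a _ => ?_
          rw [C.V_apply_swap ht a b]
          ring
      _ = M.d / 2 * (S.phi (z, t) b * C.Psi t b 0) := by rw [h4]; ring
  simp only [h3]
  rw [← Finset.mul_sum]
  have hd' : (1 : ℂ) - M.d ≠ 0 := sub_ne_zero.2 hd.symm
  field_simp
  ring

/-- The product `(1/2)(3/2)⋯(k - 1/2)`, the ratio `Γ(k + 1/2) / Γ(1/2)`. -/
def halfRising (k : ℕ) : ℝ := ∏ j ∈ Finset.range k, ((j : ℝ) + 1 / 2)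

theorem halfRising_succ (k : ℕ) : halfRising (k + 1) = halfRising k * (k + 1 / 2) :=
  Finset.prod_range_succ _ _

theorem halfRising_pos (k : ℕ) : 0 < halfRising k :=
  Finset.prod_pos fun j _ => by positivity

theorem halfRising_ne_zero (k : ℕ) : (halfRising k : ℂ) ≠ 0 :=
  Complex.ofReal_ne_zero.2 (halfRising_pos k).ne'

/-- The Borel transform of the `i`-th row of `R⁻¹` is the Frobenius series with exponent `-1/2`. -/
theorem CanonicalCoordinates.IsRMatrix.isFrobeniusSeries
    {R : (Fin n → ℂ) → PowerSeries (Matrix (Fin n) (Fin n) ℂ)} (hR : C.IsRMatrix R)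
    (ht : t ∈ C.B₀) (i : Fin n) :
    IsFrobeniusSeries (C.u t) (C.V t) i (-(1 / 2))
      fun k a => PowerSeries.coeff k (invSeries (R t)) i a / halfRising k := by
  intro k a
  have h1 := hR.invSeries_row ht i a k
  have h2 := halfRising_ne_zero k
  have h3 := natCast_add_half_ne_zero k
  have h4 : ∑ b, C.V t a b * (PowerSeries.coeff k (invSeries (R t)) i b / (halfRising k : ℂ))
      = (∑ b, C.V t a b * PowerSeries.coeff k (invSeries (R t)) i b) / halfRising k := by
    rw [Finset.sum_div]
    exact Finset.sum_congr rfl fun b _ => by ring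
  beta_reduce
  rw [h4, halfRising_succ]
  generalize ∑ b, C.V t a b * PowerSeries.coeff k (invSeries (R t)) i b = W at *
  push_cast
  have h5 : ((k : ℂ) + 1 + -(1 / 2)) = k + 1 / 2 := by ring
  rw [h5, add_neg_cancel_right]
  generalize (k : ℂ) + 1 / 2 = x at *
  field_simp
  linear_combination h1

/-- The coefficients of the Borel transform of `R⁻¹(z) 𝟙`. -/
def borelCoeff (C : CanonicalCoordinates M)
    (R : (Fin n → ℂ) → PowerSeries (Matrix (Fin n) (Fin n) ℂ)) (t : Fin n → ℂ) (i : Fin n)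
    (k : ℕ) : ℂ := invRUnitCoeff C R t i k / halfRising k

/-- The superpotential near `u_i` is `√(u_i - λ) A(u_i - λ) + B(u_i - λ)`, where the coefficients of
`A` are those of the Borel transform of `R⁻¹(z) 𝟙`, integrated term by term. -/
theorem SuperpotentialData.exists_P_eq (S : SuperpotentialData K) (hd : M.d ≠ 1)
    {R : (Fin n → ℂ) → PowerSeries (Matrix (Fin n) (Fin n) ℂ)} (hR : C.IsRMatrix R)
    (ht : t ∈ C.B₀) (i : Fin n) :
    ∃ r : ℝ, 0 < r ∧
      IsRootDomain (C.u t) i r (Metric.ball (C.u t i) r ∩ slitPlane (C.u t) K.ν)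
        (fun z => K.root i (z, t)) ∧
      ConvergesAt r (borelCoeff C R t i) ∧ ∃ b : ℕ → ℂ, ConvergesAt r b ∧
        ∀ z ∈ Metric.ball (C.u t i) r ∩ slitPlane (C.u t) K.ν,
          S.P (z, t) = K.root i (z, t) * ((Real.sqrt 2 : ℂ) / 2
              * pseries (fun k => borelCoeff C R t i k / (k + 1 / 2)) (C.u t i - z))
            + pseries b (C.u t i - z) := by
  have hV := fun a b => C.V_apply_swap ht a b
  have hu := fun a (ha : a ≠ i) => K.u_ne ht ha
  obtain ⟨r₀, hr₀, hrad₀⟩ := exists_radius hu (V := C.V t)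
    (by linear_combination (1 / 2 : ℂ) * hV i i)
  obtain ⟨δ, hδ, hdom⟩ := K.exists_isRootDomain ht i
  set r := min r₀ δ with hrdef
  have hr : 0 < r := lt_min hr₀ hδ
  have hrad : ∀ ρ : ℝ, -(1 / 2) ≤ ρ → ∀ f, IsFrobeniusSeries (C.u t) (C.V t) i ρ f →
      ∀ a, ConvergesAt r fun k => f k a := fun ρ hρ f hf a =>
    (hrad₀ ρ hρ f hf a).mono hr.le (min_le_left _ _)
  have h := hdom r hr (min_le_right _ _)
  set T := Metric.ball (C.u t i) r ∩ slitPlane (C.u t) K.ν with hT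
  have hTs : T ⊆ slitPlane (C.u t) K.ν := Set.inter_subset_right
  have hχ := hR.isFrobeniusSeries ht i
  obtain ⟨g, hg, hphi⟩ := IsLocalSolution.eq_singular_add_regular hu hV hr hrad h hχ
    (by
      funext a
      simp [coeff_zero_invSeries, halfRising, Matrix.one_apply, Pi.single_apply, eq_comm])
    ((S.isDubrovinSystem.solution i).isLocalSolution ht hTs) (S.hasLeadingVector ht hTs h)
    (S.isLocalSolution_phi ht hTs) fun z hz => S.uForm_phi ht (hTs hz) i
  have hcχ := hrad _ le_rfl _ hχ
  have hχ1 : ∀ k, ∑ a, C.Psi t a 0 * (PowerSeries.coeff k (invSeries (R t)) i a / halfRising k)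
      = borelCoeff C R t i k := by
    intro k
    rw [borelCoeff, invRUnitCoeff, Finset.sum_div]
    exact Finset.sum_congr rfl fun a _ => by rw [C.Psi_zero ht]; ring
  have hm : ConvergesAt r (borelCoeff C R t i) := by
    have := ConvergesAt.sum hr.le Finset.univ
      fun a _ => (hcχ a).const_mul hr.le (C.Psi t a 0)
    simpa only [hχ1] using this
  -- the integrated coefficients
  set α : ℕ → ℂ := fun k => borelCoeff C R t i k / (k + 1 / 2) with hα
  have hαc : ConvergesAt r α := hm.div_half hr.le
  set e : ℕ → ℂ := fun k => ∑ a, C.Psi t a 0 * g k a with he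
  have hec : ConvergesAt r e :=
    ConvergesAt.sum hr.le Finset.univ fun a _ => (hg a).const_mul hr.le (C.Psi t a 0)
  -- at `k = 0` the division by zero gives the coefficient `0`; the constant of integration is added
  -- at the end
  set b₁ : ℕ → ℂ := fun k => (Real.sqrt 2 : ℂ) / 2 * (e (k - 1) / k) with hb₁
  have hb₁c : ConvergesAt r b₁ := by
    refine ConvergesAt.unshift ?_ hr.le
    have : ∀ k : ℕ, ‖((Real.sqrt 2 : ℂ) / 2) / ((k + 1 : ℕ) : ℂ)‖ ≤ ‖(Real.sqrt 2 : ℂ) / 2‖ := by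
      intro k
      rw [norm_div, Complex.norm_natCast]
      exact div_le_self (norm_nonneg _) (by exact_mod_cast Nat.le_add_left 1 k)
    have h2 := hec.mul_bounded hr.le this
    convert! h2 using 2 with k
    simp only [hb₁, add_tsub_cancel_right]
    ring
  have hderiv : ∀ z ∈ T, HasDerivAt (fun z => S.P (z, t) - (K.root i (z, t)
      * ((Real.sqrt 2 : ℂ) / 2 * pseries α (C.u t i - z)) + pseries b₁ (C.u t i - z))) 0 z := by
    intro z hz
    have hs := h.norm_lt z hz
    have hsub := (hasDerivAt_id z).const_sub (C.u t i)
    have hA := ((hαc.hasDerivAt hs).comp z hsub).const_mul ((Real.sqrt 2 : ℂ) / 2)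
    have hB := (hb₁c.hasDerivAt hs).comp z hsub
    have h1 := (S.hasDerivAt_P hd ht (hTs hz)).sub (((h.hasDerivAt_root hz).mul hA).add hB)
    convert! h1 using 1
    have hroot := h.root_ne_zero hz
    have hsq := h.root_sq z hz
    have hhalf := hαc.half_add_mul_deriv hs
    have hαm : (fun k : ℕ => ((k : ℂ) + 1 / 2) * α k) = borelCoeff C R t i := by
      funext k
      simp only [hα]
      rw [mul_div_cancel₀ _ (natCast_add_half_ne_zero k)]
    have hb₁d : (fun k : ℕ => ((k + 1 : ℕ) : ℂ) * b₁ (k + 1))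
        = fun k => (Real.sqrt 2 : ℂ) / 2 * e k := by
      funext k
      have : ((k + 1 : ℕ) : ℂ) ≠ 0 := Nat.cast_ne_zero.2 k.succ_ne_zero
      simp only [hb₁, add_tsub_cancel_right]
      field_simp
    have hsum : ∑ a, S.phi (z, t) a * C.Psi t a 0
        = (K.root i (z, t))⁻¹ * pseries (borelCoeff C R t i) (C.u t i - z)
          + pseries e (C.u t i - z) := by
      have e1 := pseries_sum Finset.univ
        (fun a _ => (hcχ a).const_mul hr.le (C.Psi t a 0)) hs
      have e2 := pseries_sum Finset.univ
        (fun a _ => (hg a).const_mul hr.le (C.Psi t a 0)) hs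
      simp only [hχ1, pseries_const_mul] at e1 e2
      rw [e1, he, e2, Finset.mul_sum, ← Finset.sum_add_distrib]
      refine Finset.sum_congr rfl fun a _ => ?_
      rw [hphi z hz a]
      ring
    rw [hsum, hb₁d, pseries_const_mul, ← hαm, ← hhalf, ← hsq]
    simp only [Function.comp_apply, ← hsq]
    field_simp
    ring
  obtain ⟨c, hc⟩ := h.isOpen.exists_is_const_of_deriv_eq_zero h.isPreconnected
    (fun z hz => (hderiv z hz).differentiableAt.differentiableWithinAt)
    fun z hz => (hderiv z hz).deriv
  refine ⟨r, hr, h, hm, fun k => b₁ k + if k = 0 then c else 0, ?_, fun z hz => ?_⟩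
  · refine ConvergesAt.unshift ?_ hr.le
    simpa using hb₁c.shift hr
  · have hs := h.norm_lt z hz
    have h2 : HasSum (fun k => (b₁ k + if k = 0 then c else 0) * (C.u t i - z) ^ k)
        (pseries b₁ (C.u t i - z) + c) := by
      have h3 := (hb₁c.hasSum hs).add (hasSum_ite_eq 0 c)
      refine h3.congr_fun fun k => ?_
      by_cases hk : k = 0 <;> simp [hk]
    have h4 : pseries (fun k => b₁ k + if k = 0 then c else 0) (C.u t i - z)
        = pseries b₁ (C.u t i - z) + c := h2.tsum_eq
    rw [h4, ← hc z hz]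
    ring

end Superpotential

/-! ### Laplace expansions -/

section Laplace

open MeasureTheory

theorem Gamma_natCast_add_half (k : ℕ) :
    Real.Gamma (k + 1 / 2) = halfRising k * Real.sqrt Real.pi := by
  induction k with
  | zero => simpa [halfRising] using Real.Gamma_one_half_eq
  | succ k ih =>
    have h : ((k + 1 : ℕ) : ℝ) + 1 / 2 = (k + 1 / 2) + 1 := by push_cast; ring
    rw [h, Real.Gamma_add_one (by positivity), ih, halfRising_succ]
    ring

theorem integrable_pow_mul_gaussian (k : ℕ) {ζ : ℝ} (hζ : 0 < ζ) :
    Integrable fun w : ℝ => w ^ (2 * k) * Real.exp (-ζ * w ^ 2 / 2) := by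
  have h := integrable_rpow_mul_exp_neg_mul_sq (half_pos hζ) (s := ((2 * k : ℕ) : ℝ))
    (by have : (0 : ℝ) ≤ ((2 * k : ℕ) : ℝ) := Nat.cast_nonneg _
        linarith)
  refine h.congr (Eventually.of_forall fun w => ?_)
  simp only [Real.rpow_natCast]
  congr 2
  ring

/-- The even moments of the normalized Gaussian weight. -/
theorem gaussian_moment (k : ℕ) {ζ : ℝ} (hζ : 0 < ζ) :
    Real.sqrt ζ / Real.sqrt (2 * Real.pi) * ∫ w : ℝ, w ^ (2 * k) * Real.exp (-ζ * w ^ 2 / 2)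
      = 2 ^ k * halfRising k * ζ⁻¹ ^ k := by
  have h1 : ∫ w : ℝ, w ^ (2 * k) * Real.exp (-ζ * w ^ 2 / 2)
      = 2 * ∫ w in Set.Ioi (0 : ℝ), w ^ ((2 * k : ℕ) : ℝ) * Real.exp (-(ζ / 2) * w ^ (2 : ℝ)) := by
    rw [← integral_comp_abs]
    refine integral_congr_ae (Eventually.of_forall fun w => ?_)
    have : ∀ x : ℝ, x ^ (2 : ℝ) = x ^ 2 := fun x => Real.rpow_two x
    simp only [Real.rpow_natCast, this, sq_abs, pow_mul]
    congr 2
    ring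
  rw [h1, integral_rpow_mul_exp_neg_mul_rpow two_pos
    (by have : (0 : ℝ) ≤ ((2 * k : ℕ) : ℝ) := Nat.cast_nonneg _
        linarith) (half_pos hζ)]
  have h2 : (((2 * k : ℕ) : ℝ) + 1) / 2 = k + 1 / 2 := by push_cast; ring
  have h3 : -(((2 * k : ℕ) : ℝ) + 1) / 2 = -(k : ℝ) + -(1 / 2) := by push_cast; ring
  have h4 : Real.sqrt 2 ≠ 0 := by positivity
  have h5 : Real.sqrt Real.pi ≠ 0 := (Real.sqrt_pos.2 Real.pi_pos).ne'
  have h6 : Real.sqrt ζ ≠ 0 := (Real.sqrt_pos.2 hζ).ne'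
  rw [h2, h3, Real.rpow_add (half_pos hζ), Real.rpow_neg (half_pos hζ).le,
    Real.rpow_neg (half_pos hζ).le, Real.rpow_natCast, ← Real.sqrt_eq_rpow,
    Gamma_natCast_add_half, Real.sqrt_mul two_pos.le, Real.sqrt_div hζ.le, inv_pow, div_pow]
  field_simp

/-- The Gaussian weight `e^{-ζ w²/2}`, as in `HasLaplaceExpansion`. -/
def gaussianWeight (ζ w : ℝ) : ℂ := Complex.exp (-(ζ : ℂ) * (w : ℂ) ^ 2 / 2)

theorem gaussianWeight_eq (ζ w : ℝ) :
    gaussianWeight ζ w = (Real.exp (-ζ * w ^ 2 / 2) : ℝ) := by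
  rw [gaussianWeight]
  push_cast
  rfl

theorem norm_gaussianWeight (ζ w : ℝ) : ‖gaussianWeight ζ w‖ = Real.exp (-ζ * w ^ 2 / 2) := by
  rw [gaussianWeight_eq, Complex.norm_real, Real.norm_of_nonneg (Real.exp_pos _).le]

theorem gaussianWeight_add (ζ ζ' w : ℝ) :
    gaussianWeight (ζ + ζ') w = gaussianWeight ζ w * gaussianWeight ζ' w := by
  rw [gaussianWeight, gaussianWeight, gaussianWeight, ← Complex.exp_add]
  congr 1
  push_cast
  ring

theorem continuous_gaussianWeight (ζ : ℝ) : Continuous (gaussianWeight ζ) := by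
  unfold gaussianWeight
  fun_prop

/-- The factor `√ζ/√(2π)`. -/
def laplaceFactor (ζ : ℝ) : ℂ := ((Real.sqrt ζ / Real.sqrt (2 * Real.pi) : ℝ) : ℂ)

theorem norm_laplaceFactor_le {ζ : ℝ} (hζ : 1 ≤ ζ) : ‖laplaceFactor ζ‖ ≤ ζ := by
  rw [laplaceFactor, Complex.norm_real, Real.norm_of_nonneg (by positivity)]
  have h1 : 1 ≤ Real.sqrt (2 * Real.pi) := by
    rw [Real.one_le_sqrt]
    linarith [Real.two_le_pi]
  calc Real.sqrt ζ / Real.sqrt (2 * Real.pi) ≤ Real.sqrt ζ := div_le_self (Real.sqrt_nonneg _) h1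
    _ ≤ ζ := by
      rw [Real.sqrt_le_left (by linarith)]
      nlinarith

theorem integrable_gaussianWeight_of_le {g : ℝ → ℂ} {ζ₀ ζ : ℝ}
    (hg : Integrable fun w => g w * gaussianWeight ζ₀ w) (h : ζ₀ ≤ ζ) :
    Integrable fun w => g w * gaussianWeight ζ w := by
  have h1 : ∀ w, g w * gaussianWeight ζ w
      = gaussianWeight (ζ - ζ₀) w * (g w * gaussianWeight ζ₀ w) := by
    intro w
    rw [mul_left_comm, ← gaussianWeight_add, sub_add_cancel]
  simp only [h1]
  refine hg.bdd_mul (c := 1) (continuous_gaussianWeight _).aestronglyMeasurable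
    (Eventually.of_forall fun w => ?_)
  rw [norm_gaussianWeight, Real.exp_le_one_iff]
  nlinarith [mul_nonneg (sub_nonneg.2 h) (sq_nonneg w)]

/-- The integral away from `0` is exponentially small. -/
theorem isBigO_laplace_tail {g : ℝ → ℂ} {ζ₀ : ℝ}
    (hg : Integrable fun w => g w * gaussianWeight ζ₀ w) {ε : ℝ} (hε : 0 < ε) (m : ℕ) :
    (fun ζ : ℝ => laplaceFactor ζ * ∫ w in (Set.Ioo (-ε) ε)ᶜ, g w * gaussianWeight ζ w)
      =O[atTop] fun ζ : ℝ => ζ⁻¹ ^ m := by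
  set I₀ : ℝ := ∫ w, ‖g w * gaussianWeight ζ₀ w‖ with hI₀
  have hI₀0 : 0 ≤ I₀ := integral_nonneg fun w => norm_nonneg _
  set κ : ℝ := ε ^ 2 / 2 with hκ
  have hκ0 : 0 < κ := by positivity
  have h1 : (fun ζ : ℝ => laplaceFactor ζ * ∫ w in (Set.Ioo (-ε) ε)ᶜ, g w * gaussianWeight ζ w)
      =O[atTop] fun ζ : ℝ => ζ * Real.exp (-κ * ζ) := by
    refine IsBigO.of_bound (Real.exp (κ * ζ₀) * I₀) ?_
    filter_upwards [eventually_ge_atTop 1, eventually_ge_atTop ζ₀] with ζ hζ1 hζ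
    have hb : ‖∫ w in (Set.Ioo (-ε) ε)ᶜ, g w * gaussianWeight ζ w‖
        ≤ Real.exp (-κ * (ζ - ζ₀)) * I₀ := by
      calc ‖∫ w in (Set.Ioo (-ε) ε)ᶜ, g w * gaussianWeight ζ w‖
          ≤ ∫ w in (Set.Ioo (-ε) ε)ᶜ, Real.exp (-κ * (ζ - ζ₀)) * ‖g w * gaussianWeight ζ₀ w‖ := by
            refine norm_integral_le_of_norm_le (hg.norm.const_mul _).integrableOn ?_
            refine (ae_restrict_iff' measurableSet_Ioo.compl).2 (Eventually.of_forall fun w hw => ?_)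
            have h2 : g w * gaussianWeight ζ w
                = gaussianWeight (ζ - ζ₀) w * (g w * gaussianWeight ζ₀ w) := by
              rw [mul_left_comm, ← gaussianWeight_add, sub_add_cancel]
            rw [h2, norm_mul]
            refine mul_le_mul_of_nonneg_right ?_ (norm_nonneg _)
            rw [norm_gaussianWeight, Real.exp_le_exp]
            have h3 : ε ^ 2 ≤ w ^ 2 := by
              rw [sq_le_sq, abs_of_pos hε]
              by_contra hlt
              exact hw (abs_lt.1 (not_le.1 hlt))
            nlinarith [mul_le_mul_of_nonneg_left h3 (sub_nonneg.2 hζ)]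
        _ ≤ ∫ w, Real.exp (-κ * (ζ - ζ₀)) * ‖g w * gaussianWeight ζ₀ w‖ :=
            setIntegral_le_integral (hg.norm.const_mul _)
              (Eventually.of_forall fun w => by positivity)
        _ = Real.exp (-κ * (ζ - ζ₀)) * I₀ := integral_const_mul _ _
    rw [norm_mul, Real.norm_of_nonneg (by positivity)]
    calc ‖laplaceFactor ζ‖ * ‖∫ w in (Set.Ioo (-ε) ε)ᶜ, g w * gaussianWeight ζ w‖
        ≤ ζ * (Real.exp (-κ * (ζ - ζ₀)) * I₀) :=
          mul_le_mul (norm_laplaceFactor_le hζ1) hb (norm_nonneg _) (by linarith)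
      _ = Real.exp (κ * ζ₀) * I₀ * (ζ * Real.exp (-κ * ζ)) := by
          have : -κ * (ζ - ζ₀) = κ * ζ₀ + -κ * ζ := by ring
          rw [this, Real.exp_add]
          ring
  refine h1.trans ?_
  have h2 := ((isBigO_refl (fun ζ : ℝ => ζ) atTop).mul
    (isLittleO_exp_neg_mul_rpow_atTop hκ0 (-((m + 1 : ℕ) : ℝ))).isBigO)
  refine h2.trans (IsBigO.of_bound 1 ?_)
  filter_upwards [eventually_gt_atTop 0] with ζ hζ
  rw [Real.rpow_neg hζ.le, Real.rpow_natCast, pow_succ, mul_inv, one_mul, mul_left_comm,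
    mul_inv_cancel₀ hζ.ne', mul_one, inv_pow]

/-- A Laplace expansion over a neighbourhood of `0` extends to the whole line. -/
theorem HasLaplaceExpansion.univ {g : ℝ → ℂ} {ε : ℝ} {a : ℕ → ℂ} (hε : 0 < ε)
    (h : HasLaplaceExpansion g (Set.Ioo (-ε) ε) a) {ζ₀ : ℝ}
    (hg : Integrable fun w => g w * gaussianWeight ζ₀ w) :
    HasLaplaceExpansion g Set.univ a := by
  intro m
  refine ((h m).add (isBigO_laplace_tail hg hε m)).congr' ?_ EventuallyEq.rfl
  filter_upwards [eventually_ge_atTop ζ₀] with ζ hζ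
  have h1 := integral_add_compl (measurableSet_Ioo (a := -ε) (b := ε))
    (integrable_gaussianWeight_of_le hg hζ)
  simp only [gaussianWeight, laplaceFactor] at h1 ⊢
  rw [setIntegral_univ, ← h1]
  ring

/-- Truncated even moments agree with the full ones up to exponentially small terms. -/
theorem isBigO_truncated_moment (k : ℕ) {ε : ℝ} (hε : 0 < ε) (m : ℕ) :
    (fun ζ : ℝ => laplaceFactor ζ * (∫ w in Set.Ioo (-ε) ε,
        ((w : ℂ) ^ 2 / 2) ^ k * gaussianWeight ζ w) - halfRising k * (ζ : ℂ)⁻¹ ^ k)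
      =O[atTop] fun ζ : ℝ => ζ⁻¹ ^ m := by
  have heq : ∀ ζ w : ℝ, ((w : ℂ) ^ 2 / 2) ^ k * gaussianWeight ζ w
      = ((2⁻¹ ^ k * (w ^ (2 * k) * Real.exp (-ζ * w ^ 2 / 2)) : ℝ) : ℂ) := by
    intro ζ w
    rw [gaussianWeight_eq]
    push_cast
    rw [div_eq_mul_inv, mul_pow, pow_mul]
    ring
  have hint : ∀ ζ : ℝ, 0 < ζ →
      Integrable fun w : ℝ => ((w : ℂ) ^ 2 / 2) ^ k * gaussianWeight ζ w := by
    intro ζ hζ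
    simp only [heq]
    exact ((integrable_pow_mul_gaussian k hζ).const_mul _).ofReal
  refine (isBigO_laplace_tail (hint 1 one_pos) hε m).neg_left.congr' ?_ EventuallyEq.rfl
  filter_upwards [eventually_gt_atTop 0] with ζ hζ
  have h1 := integral_add_compl (measurableSet_Ioo (a := -ε) (b := ε)) (hint ζ hζ)
  have h2 : laplaceFactor ζ * ∫ w : ℝ, ((w : ℂ) ^ 2 / 2) ^ k * gaussianWeight ζ w
      = halfRising k * (ζ : ℂ)⁻¹ ^ k := by
    simp only [heq]
    rw [integral_complex_ofReal, integral_const_mul, laplaceFactor, ← Complex.ofReal_mul, mul_left_comm,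
      gaussian_moment k hζ]
    push_cast
    rw [inv_pow]
    field_simp
  rw [← h2, ← h1]
  ring

theorem ConvergesAt.exists_remainder_bound {r : ℝ} {c : ℕ → ℂ} (hc : ConvergesAt r c) {r' : ℝ}
    (hr' : 0 ≤ r') (hr : r' < r) (m : ℕ) :
    ∃ A : ℝ, ∀ s : ℂ, ‖s‖ ≤ r' →
      ‖pseries c s - ∑ k ∈ Finset.range m, c k * s ^ k‖ ≤ A * ‖s‖ ^ m := by
  induction m generalizing c with
  | zero =>
    have hcont : ContinuousOn (pseries c) (Metric.closedBall 0 r') := fun s hs =>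
      (hc.hasDerivAt ((mem_closedBall_zero_iff.1 hs).trans_lt hr)).continuousAt.continuousWithinAt
    obtain ⟨A, hA⟩ := (isCompact_closedBall (0 : ℂ) r').exists_bound_of_continuousOn hcont
    exact ⟨A, fun s hs => by simpa using hA s (mem_closedBall_zero_iff.2 hs)⟩
  | succ m ih =>
    obtain ⟨A, hA⟩ := ih (hc.shift (hr'.trans_lt hr))
    refine ⟨A, fun s hs => ?_⟩
    have h1 : pseries c s - ∑ k ∈ Finset.range (m + 1), c k * s ^ k
        = s * (pseries (fun k => c (k + 1)) s
          - ∑ k ∈ Finset.range m, c (k + 1) * s ^ k) := by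
      rw [hc.eq_shift (hs.trans_lt hr), Finset.sum_range_succ', mul_sub, Finset.mul_sum, pow_zero,
        mul_one]
      have : ∀ k, s * (c (k + 1) * s ^ k) = c (k + 1) * s ^ (k + 1) := fun k => by ring
      simp only [this]
      ring
    rw [h1, norm_mul, pow_succ, ← mul_assoc, mul_comm]
    exact mul_le_mul_of_nonneg_right (hA s hs) (norm_nonneg _)

theorem setIntegral_Ioo_eq_zero_of_odd {f : ℝ → ℂ} (hf : ∀ w, f (-w) = -f w) {ε : ℝ}
    (hε : 0 < ε) : ∫ w in Set.Ioo (-ε) ε, f w = 0 := by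
  rw [← integral_Ioc_eq_integral_Ioo, ← intervalIntegral.integral_of_le (by linarith)]
  have h1 := intervalIntegral.integral_comp_neg (a := -ε) (b := ε) f
  simp only [hf, intervalIntegral.integral_neg, neg_neg] at h1
  exact self_eq_neg.1 h1.symm

/-- Watson's lemma for the Gaussian weight: odd terms do not contribute, and the term
`c_k (w²/2)^k` contributes `(1/2)(3/2)⋯(k - 1/2) c_k ζ^{-k}`. -/
theorem hasLaplaceExpansion_of_eq {r : ℝ} {c : ℕ → ℂ} (hc : ConvergesAt r c) {ε : ℝ} (hε : 0 < ε)
    (hεr : ε ^ 2 / 2 < r) {o : ℝ → ℂ} (ho : ∀ w, o (-w) = -o w)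
    (hoc : ContinuousOn o (Set.Icc (-ε) ε)) {g : ℝ → ℂ}
    (hg : ∀ w ∈ Set.Ioo (-ε) ε, g w = pseries c ((w : ℂ) ^ 2 / 2) + o w) :
    HasLaplaceExpansion g (Set.Ioo (-ε) ε) fun k => c k * halfRising k := by
  intro m
  have hnorm : ∀ w : ℝ, ‖(w : ℂ) ^ 2 / 2‖ = w ^ 2 / 2 := by
    intro w
    rw [norm_div, norm_pow, Complex.norm_real, Real.norm_eq_abs, sq_abs, Complex.norm_ofNat]
  have hle : ∀ w ∈ Set.Icc (-ε) ε, ‖(w : ℂ) ^ 2 / 2‖ ≤ ε ^ 2 / 2 := by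
    intro w hw
    rw [hnorm]
    have := sq_le_sq' hw.1 hw.2
    linarith
  obtain ⟨A, hA⟩ := hc.exists_remainder_bound (by positivity) hεr m
  set E : ℝ → ℂ := fun w => pseries c ((w : ℂ) ^ 2 / 2) with hE
  set rem : ℝ → ℂ := fun w => E w - ∑ k ∈ Finset.range m, c k * ((w : ℂ) ^ 2 / 2) ^ k with hrem
  have hEc : ContinuousOn E (Set.Icc (-ε) ε) := by
    intro w hw
    have h1 : ContinuousAt (pseries c) ((w : ℂ) ^ 2 / 2) :=
      (hc.hasDerivAt ((hle w hw).trans_lt hεr)).continuousAt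
    have h2 : Continuous fun w : ℝ => (w : ℂ) ^ 2 / 2 := by fun_prop
    exact (ContinuousAt.comp (f := fun w : ℝ => (w : ℂ) ^ 2 / 2) h1
      h2.continuousAt).continuousWithinAt
  have hpolyc : Continuous fun w : ℝ => ∑ k ∈ Finset.range m, c k * ((w : ℂ) ^ 2 / 2) ^ k := by
    fun_prop
  have hremc : ContinuousOn rem (Set.Icc (-ε) ε) := hEc.sub hpolyc.continuousOn
  have hint : ∀ f : ℝ → ℂ, ContinuousOn f (Set.Icc (-ε) ε) → ∀ ζ : ℝ,
      IntegrableOn (fun w => f w * gaussianWeight ζ w) (Set.Ioo (-ε) ε) := fun f hf ζ =>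
    ((hf.mul (continuous_gaussianWeight ζ).continuousOn).integrableOn_Icc).mono_set
      Set.Ioo_subset_Icc_self
  -- the remainder
  have hR : (fun ζ : ℝ => laplaceFactor ζ * ∫ w in Set.Ioo (-ε) ε, rem w * gaussianWeight ζ w)
      =O[atTop] fun ζ : ℝ => ζ⁻¹ ^ m := by
    refine IsBigO.of_bound (A * halfRising m) ?_
    filter_upwards [eventually_gt_atTop 0] with ζ hζ
    have hbint : Integrable fun w : ℝ =>
        A * (2⁻¹ ^ m * (w ^ (2 * m) * Real.exp (-ζ * w ^ 2 / 2))) :=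
      ((integrable_pow_mul_gaussian m hζ).const_mul _).const_mul _
    have hA0 : 0 ≤ A := by
      have h1 := hA ((ε : ℂ) ^ 2 / 2) (hle ε ⟨by linarith, le_rfl⟩)
      rw [hnorm] at h1
      have h2 : 0 < (ε ^ 2 / 2) ^ m := by positivity
      by_contra hneg
      linarith [norm_nonneg (pseries c ((ε : ℂ) ^ 2 / 2)
        - ∑ k ∈ Finset.range m, c k * ((ε : ℂ) ^ 2 / 2) ^ k),
        mul_neg_of_neg_of_pos (not_le.1 hneg) h2]
    have hb : ‖∫ w in Set.Ioo (-ε) ε, rem w * gaussianWeight ζ w‖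
        ≤ A * (2⁻¹ ^ m * ∫ w : ℝ, w ^ (2 * m) * Real.exp (-ζ * w ^ 2 / 2)) := by
      rw [← integral_const_mul, ← integral_const_mul]
      refine le_trans (norm_integral_le_of_norm_le hbint.integrableOn ?_)
        (setIntegral_le_integral hbint (Eventually.of_forall fun w => ?_))
      · refine (ae_restrict_iff' measurableSet_Ioo).2 (Eventually.of_forall fun w hw => ?_)
        have h1 := hA _ (hle w (Set.Ioo_subset_Icc_self hw))
        rw [hnorm] at h1
        rw [norm_mul, norm_gaussianWeight]
        calc ‖rem w‖ * Real.exp (-ζ * w ^ 2 / 2)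
            ≤ A * (w ^ 2 / 2) ^ m * Real.exp (-ζ * w ^ 2 / 2) :=
              mul_le_mul_of_nonneg_right h1 (Real.exp_pos _).le
          _ = A * (2⁻¹ ^ m * (w ^ (2 * m) * Real.exp (-ζ * w ^ 2 / 2))) := by
              rw [div_eq_mul_inv, mul_pow, ← pow_mul]
              ring
      · have : 0 ≤ w ^ (2 * m) := by rw [pow_mul]; positivity
        positivity
    rw [norm_mul, laplaceFactor, Complex.norm_real, Real.norm_of_nonneg (by positivity),
      Real.norm_of_nonneg (by positivity)]
    calc Real.sqrt ζ / Real.sqrt (2 * Real.pi)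
          * ‖∫ w in Set.Ioo (-ε) ε, rem w * gaussianWeight ζ w‖
        ≤ Real.sqrt ζ / Real.sqrt (2 * Real.pi)
          * (A * (2⁻¹ ^ m * ∫ w : ℝ, w ^ (2 * m) * Real.exp (-ζ * w ^ 2 / 2))) :=
          mul_le_mul_of_nonneg_left hb (by positivity)
      _ = A * (2⁻¹ ^ m * (Real.sqrt ζ / Real.sqrt (2 * Real.pi)
          * ∫ w : ℝ, w ^ (2 * m) * Real.exp (-ζ * w ^ 2 / 2))) := by ring
      _ = A * halfRising m * ζ⁻¹ ^ m := by
          rw [gaussian_moment m hζ, inv_pow 2]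
          field_simp
  have hM := IsBigO.sum fun k (_ : k ∈ Finset.range m) =>
    (isBigO_truncated_moment k hε m).const_mul_left (c k)
  refine (hM.add hR).congr' (Eventually.of_forall fun ζ => ?_) EventuallyEq.rfl
  have h1 : ∫ w in Set.Ioo (-ε) ε, g w * gaussianWeight ζ w
      = ((∑ k ∈ Finset.range m,
          c k * ∫ w in Set.Ioo (-ε) ε, ((w : ℂ) ^ 2 / 2) ^ k * gaussianWeight ζ w)
        + ∫ w in Set.Ioo (-ε) ε, rem w * gaussianWeight ζ w)
        + ∫ w in Set.Ioo (-ε) ε, o w * gaussianWeight ζ w := by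
    have hk : ∀ k ∈ Finset.range m, IntegrableOn
        (fun w : ℝ => c k * (((w : ℂ) ^ 2 / 2) ^ k * gaussianWeight ζ w)) (Set.Ioo (-ε) ε) :=
      fun k _ => (hint (fun w : ℝ => ((w : ℂ) ^ 2 / 2) ^ k)
        (Continuous.continuousOn (by fun_prop)) ζ).const_mul (c k)
    have hI : IntegrableOn (fun w : ℝ => ∑ k ∈ Finset.range m,
        c k * (((w : ℂ) ^ 2 / 2) ^ k * gaussianWeight ζ w) + rem w * gaussianWeight ζ w)
        (Set.Ioo (-ε) ε) := (integrable_finsetSum _ hk).add (hint rem hremc ζ)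
    simp only [← integral_const_mul]
    rw [← integral_finsetSum _ hk, ← integral_add (integrable_finsetSum _ hk) (hint rem hremc ζ),
      ← integral_add hI (hint o hoc ζ)]
    refine setIntegral_congr_fun measurableSet_Ioo fun w hw => ?_
    simp only [hg w hw, hrem, hE, sub_mul, Finset.sum_mul, mul_assoc, add_mul]
    ring
  have h2 : ∫ w in Set.Ioo (-ε) ε, o w * gaussianWeight ζ w = 0 := by
    refine setIntegral_Ioo_eq_zero_of_odd (fun w => ?_) hε
    rw [ho, gaussianWeight_eq, gaussianWeight_eq, neg_sq, neg_mul]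
  rw [h2, add_zero] at h1
  simp only [gaussianWeight, laplaceFactor] at h1 ⊢
  rw [h1, mul_add, Finset.mul_sum, Finset.sum_apply, add_sub_right_comm, ← Finset.sum_sub_distrib]
  congr 1
  exact Finset.sum_congr rfl fun k _ => by ring

end Laplace

/-! ### The superpotential as a function of the local coordinate -/

section BranchFunction

variable {r : ℝ} {m b : ℕ → ℂ} {w : ℂ}

theorem ConvergesAt.deriv {r' : ℝ} (hb : ConvergesAt r b) (hr' : 0 ≤ r') (h : r' < r) :
    ConvergesAt r' fun k => ((k + 1 : ℕ) : ℂ) * b (k + 1) := by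
  obtain ⟨A, hA⟩ := hb
  have hs := summable_deriv_bound r' hr' h A
  have hA0 : 0 ≤ A := by
    have := hA 0
    simp only [pow_zero, mul_one] at this
    exact (norm_nonneg _).trans this
  refine ⟨∑' k : ℕ, A / r * ((k + 1 : ℕ) * (r' / r) ^ k), fun k => ?_⟩
  have h1 := ConvergesAt.norm_deriv_coeff_le hA (hr'.trans_lt h) (s := (r' : ℂ)) (r' := r')
    (by rw [Complex.norm_real, Real.norm_of_nonneg hr']) k
  rw [norm_mul, norm_pow, Complex.norm_real, Real.norm_of_nonneg hr'] at h1
  refine h1.trans (hs.le_tsum k fun j _ => ?_)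
  have : 0 < r := hr'.trans_lt h
  positivity

/-- The function `w/2 · Σ_k m_k/(k + 1/2) s^k + Σ_k b_k s^k` with `s = w²/2`. -/
def branchFun (m b : ℕ → ℂ) (w : ℂ) : ℂ :=
  w / 2 * pseries (fun k => m k / (k + 1 / 2)) (w ^ 2 / 2) + pseries b (w ^ 2 / 2)

/-- The derivative of `branchFun`: its even part is `Σ_k m_k s^k`. -/
def branchDeriv (m b : ℕ → ℂ) (w : ℂ) : ℂ :=
  pseries m (w ^ 2 / 2) + w * pseries (fun k => ((k + 1 : ℕ) : ℂ) * b (k + 1)) (w ^ 2 / 2)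

theorem hasDerivAt_branchFun (hm : ConvergesAt r m) (hb : ConvergesAt r b)
    (hw : ‖w ^ 2 / 2‖ < r) : HasDerivAt (branchFun m b) (branchDeriv m b w) w := by
  have hr : 0 < r := (norm_nonneg _).trans_lt hw
  have hα := hm.div_half hr.le
  have hsq : HasDerivAt (fun w : ℂ => w ^ 2 / 2) w w := by
    simpa using (hasDerivAt_pow 2 w).div_const 2
  have h1 := (((hasDerivAt_id w).div_const 2).mul ((hα.hasDerivAt hw).comp w hsq)).add
    ((hb.hasDerivAt hw).comp w hsq)
  convert! h1 using 1
  have h2 := hα.half_add_mul_deriv hw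
  have h3 : (fun k : ℕ => ((k : ℂ) + 1 / 2) * (m k / (k + 1 / 2))) = m := by
    funext k
    exact mul_div_cancel₀ _ (natCast_add_half_ne_zero k)
  rw [h3] at h2
  rw [branchDeriv, ← h2]
  simp only [Function.comp_apply, id]
  ring

theorem eventually_norm_sq_lt (hr : 0 < r) : ∀ᶠ w : ℂ in 𝓝 0, ‖w ^ 2 / 2‖ < r := by
  have h : Continuous fun w : ℂ => ‖w ^ 2 / 2‖ := by fun_prop
  exact (h.tendsto 0).eventually (gt_mem_nhds (by simpa using hr))

theorem analyticAt_branchFun (hr : 0 < r) (hm : ConvergesAt r m) (hb : ConvergesAt r b) :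
    AnalyticAt ℂ (branchFun m b) 0 := by
  refine Complex.analyticAt_iff_eventually_differentiableAt.2 ?_
  filter_upwards [eventually_norm_sq_lt hr] with w hw
  exact (hasDerivAt_branchFun hm hb hw).differentiableAt

theorem branchDeriv_zero (m b : ℕ → ℂ) : branchDeriv m b 0 = m 0 := by
  simp [branchDeriv, pseries_zero]

/-- The Laplace expansion of a function which agrees with `branchDeriv` near `0`. -/
theorem eventually_hasLaplaceExpansion (hr : 0 < r) (hm : ConvergesAt r m)
    (hb : ConvergesAt r b) {g : ℝ → ℂ} (hg : ∀ᶠ s : ℝ in 𝓝 0, g s = branchDeriv m b s) :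
    ∀ᶠ ε in 𝓝[>] (0 : ℝ), HasLaplaceExpansion g (Set.Ioo (-ε) ε) fun k => m k * halfRising k := by
  obtain ⟨ε₀, hε₀, hball⟩ := Metric.eventually_nhds_iff_ball.1 hg
  have h1 : ∀ᶠ ε : ℝ in 𝓝[>] 0, ε ^ 2 / 2 < r / 2 := by
    have h : Continuous fun ε : ℝ => ε ^ 2 / 2 := by fun_prop
    exact ((h.tendsto 0).mono_left nhdsWithin_le_nhds).eventually
      (gt_mem_nhds (by simpa using hr))
  have h2 : ∀ᶠ ε : ℝ in 𝓝[>] 0, ε < ε₀ := nhdsWithin_le_nhds (gt_mem_nhds hε₀)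
  filter_upwards [h1, h2, self_mem_nhdsWithin] with ε hεr hεε₀ hε
  have hε' : 0 < ε := hε
  have hb' := hb.deriv (r' := r / 2) (by linarith) (by linarith)
  refine hasLaplaceExpansion_of_eq hm hε' (hεr.trans (by linarith))
    (o := fun s : ℝ => (s : ℂ) * pseries (fun k => ((k + 1 : ℕ) : ℂ) * b (k + 1))
      ((s : ℂ) ^ 2 / 2)) (fun s => ?_) (fun s hs => ?_) fun s hs => ?_
  · push_cast
    rw [neg_sq, neg_mul]
  · have h3 : ‖(s : ℂ) ^ 2 / 2‖ < r / 2 := by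
      rw [norm_div, norm_pow, Complex.norm_real, Real.norm_eq_abs, sq_abs, Complex.norm_ofNat]
      have := sq_le_sq' hs.1 hs.2
      linarith
    have h4 : Continuous fun s : ℝ => (s : ℂ) ^ 2 / 2 := by fun_prop
    have h5 := ContinuousAt.comp (f := fun s : ℝ => (s : ℂ) ^ 2 / 2) (x := s)
      (hb'.hasDerivAt h3).continuousAt h4.continuousAt
    exact (Complex.continuous_ofReal.continuousAt.mul h5).continuousWithinAt
  · rw [hball s]
    · rfl
    · rw [Metric.mem_ball, Real.dist_0_eq_abs]
      exact (abs_lt.2 hs).trans hεε₀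

end BranchFunction

/-! ### Local coordinates of the curve -/

section Charts

variable {D : Type*} [TopologicalSpace D] [ChartedSpace ℂ D]

/-- A holomorphic function on an open subset of a Riemann surface, read in a chart. -/
theorem analyticAt_comp_symm {f : D → ℂ} {N : Set D} (hN : IsOpen N)
    (hf : MDifferentiableOn 𝓘(ℂ, ℂ) 𝓘(ℂ, ℂ) f N) {e : OpenPartialHomeomorph D ℂ}
    (he : e ∈ IsManifold.maximalAtlas 𝓘(ℂ, ℂ) 1 D) {y : ℂ} (hy : y ∈ e.target)
    (hyN : e.symm y ∈ N) : AnalyticAt ℂ (fun y => f (e.symm y)) y := by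
  have h1 : MDifferentiableOn 𝓘(ℂ, ℂ) 𝓘(ℂ, ℂ) e.symm e.target :=
    (contMDiffOn_symm_of_mem_maximalAtlas he).mdifferentiableOn one_ne_zero
  have h2 : MDifferentiableOn 𝓘(ℂ, ℂ) 𝓘(ℂ, ℂ) (f ∘ e.symm) (e.target ∩ e.symm ⁻¹' N) :=
    hf.comp (h1.mono Set.inter_subset_left) Set.inter_subset_right
  exact (mdifferentiableOn_iff_differentiableOn.1 h2).analyticAt
    ((e.isOpen_inter_preimage_symm hN).mem_nhds ⟨hy, hyN⟩)

/-- A holomorphic function of a chart with nonvanishing derivative is again a local coordinate. -/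
theorem exists_localCoord_of_deriv_ne_zero [IsManifold 𝓘(ℂ, ℂ) 1 D] (c : D) {g : ℂ → ℂ}
    (hg : AnalyticAt ℂ g (chartAt ℂ c c)) (hg' : deriv g (chartAt ℂ c c) ≠ 0) :
    ∃ w ∈ IsManifold.maximalAtlas 𝓘(ℂ, ℂ) 1 D, c ∈ w.source ∧
      w.source ⊆ (chartAt ℂ c).source ∧ ∀ z, w z = g (chartAt ℂ c z) := by
  set e := chartAt ℂ c with he
  set y₀ := e c with hy₀
  have hev : ∀ᶠ y in 𝓝 y₀, AnalyticAt ℂ g y ∧ deriv g y ≠ 0 :=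
    hg.eventually_analyticAt.and (hg.deriv.continuousAt.eventually_ne hg')
  obtain ⟨S, hS, hSo, hyS⟩ := eventually_nhds_iff.1 hev
  have hstrict : HasStrictFDerivAt g
      ((ContinuousLinearEquiv.unitsEquivAut ℂ (Units.mk0 _ hg') : ℂ ≃L[ℂ] ℂ) : ℂ →L[ℂ] ℂ) y₀ :=
    hg.hasStrictDerivAt.hasStrictFDerivAt_equiv hg'
  set G := (hstrict.toOpenPartialHomeomorph g).restrOpen S hSo with hG
  have hGS : G.source ⊆ S := fun y hy => hy.2
  have hGcoe : ∀ y, G y = g y := fun y => rfl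
  have hG1 : ContDiffOn ℂ 1 G G.source := fun y hy =>
    ((hS y (hGS hy)).1.contDiffAt).contDiffWithinAt
  have hG2 : ContDiffOn ℂ 1 G.symm G.target := by
    intro y hy
    have hx := G.map_target hy
    have h1 := (hS _ (hGS hx)).1.differentiableAt.hasDerivAt
    exact (G.contDiffAt_symm_deriv (hS _ (hGS hx)).2 hy h1
      (hS _ (hGS hx)).1.contDiffAt).contDiffWithinAt
  refine ⟨e.trans G, OpenPartialHomeomorph.mem_maximalAtlas_of_contMDiffOn _ ?_ ?_, ?_, ?_,
    fun z => rfl⟩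
  · rw [OpenPartialHomeomorph.coe_trans]
    exact (contMDiffOn_iff_contDiffOn.2 hG1).comp (contMDiffOn_chart.mono fun z hz => hz.1)
      fun z hz => hz.2
  · rw [OpenPartialHomeomorph.coe_trans_symm]
    exact contMDiffOn_chart_symm.comp
      ((contMDiffOn_iff_contDiffOn.2 hG2).mono fun z hz => hz.1) fun z hz => hz.2
  · exact ⟨mem_chart_source ℂ c, hstrict.mem_toOpenPartialHomeomorph_source, hyS⟩
  · exact fun z hz => hz.1

end Charts

section Curve

variable {n : ℕ} [NeZero n] {M : FrobeniusManifold n} {C : CanonicalCoordinates M} {K : Cuts C}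
  {S : SuperpotentialData K} {t : Fin n → ℂ} {D : Type*} [TopologicalSpace D] [ChartedSpace ℂ D]

theorem DubrovinCurve.lam_c (X : DubrovinCurve S t D) (ht : t ∈ C.B₀) (i : Fin n) :
    X.lam (X.c i) = C.u t i := by
  have := K.neBot ht i
  have h1 : Tendsto (fun z => X.lam (X.sheet z)) (𝓝[slitPlane (C.u t) K.ν] (C.u t i))
      (𝓝 (X.lam (X.c i))) := (X.holo_lam (X.c i)).continuousAt.tendsto.comp (X.tendsto_sheet i)
  have h2 : Tendsto (fun z : ℂ => z) (𝓝[slitPlane (C.u t) K.ν] (C.u t i)) (𝓝 (C.u t i)) :=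
    tendsto_id.mono_left nhdsWithin_le_nhds
  refine tendsto_nhds_unique h1 (h2.congr' ?_)
  filter_upwards [self_mem_nhdsWithin] with z hz
  exact (X.lam_sheet z hz).symm

/-- The function `√2 √(u_i - λ)` on the sheet. -/
def sheetCoord (K : Cuts C) (t : Fin n → ℂ) (i : Fin n) (z : ℂ) : ℂ :=
  (Real.sqrt 2 : ℂ) * K.root i (z, t)

theorem sheetCoord_sq (ht : t ∈ C.B₀) (i : Fin n) {z : ℂ} (hz : z ∈ slitPlane (C.u t) K.ν) :
    sheetCoord K t i z ^ 2 / 2 = C.u t i - z := by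
  have h2 : (Real.sqrt 2 : ℂ) ^ 2 = 2 := by
    rw [← Complex.ofReal_pow, Real.sq_sqrt two_pos.le]
    norm_num
  rw [sheetCoord, mul_pow, h2, K.root_sq i (z, t) ht hz]
  ring

theorem tendsto_sheetCoord (ht : t ∈ C.B₀) (i : Fin n) :
    Tendsto (sheetCoord K t i) (𝓝[slitPlane (C.u t) K.ν] (C.u t i)) (𝓝[≠] 0) := by
  obtain ⟨δ, hδ, hdom⟩ := K.exists_isRootDomain ht i
  have h := hdom δ hδ le_rfl
  have hF : 𝓝[Metric.ball (C.u t i) δ ∩ slitPlane (C.u t) K.ν] (C.u t i)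
      = 𝓝[slitPlane (C.u t) K.ν] (C.u t i) :=
    nhdsWithin_inter_of_mem (mem_nhdsWithin_of_mem_nhds (Metric.ball_mem_nhds _ hδ))
  rw [← hF]
  refine tendsto_nhdsWithin_iff.2 ⟨?_, ?_⟩
  · have h1 := h.tendsto_root.const_mul (Real.sqrt 2 : ℂ)
    rw [mul_zero] at h1
    exact h1
  · filter_upwards [self_mem_nhdsWithin] with z hz
    have h2 : (Real.sqrt 2 : ℂ) ≠ 0 := Complex.ofReal_ne_zero.2 (by positivity)
    exact mul_ne_zero h2 (h.root_ne_zero hz)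

variable {m b : ℕ → ℂ} {r : ℝ} {i : Fin n}

/-- A local coordinate `w_i` whose sign is fixed on the sheet: in it, the function `p` is the same
branch function for every choice of the coordinate and of the curve. -/
theorem DubrovinCurve.IsLocalCoord.p_eventuallyEq [IsManifold 𝓘(ℂ, ℂ) 1 D]
    {X : DubrovinCurve S t D} (ht : t ∈ C.B₀) (hr : 0 < r) (hm : ConvergesAt r m)
    (hb : ConvergesAt r b)
    (hP : ∀ᶠ z in 𝓝[slitPlane (C.u t) K.ν] (C.u t i),
      S.P (z, t) = branchFun m b (sheetCoord K t i z))
    {w : OpenPartialHomeomorph D ℂ} (hw : X.IsLocalCoord i w) :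
    (fun s : ℂ => X.p (w.symm s)) =ᶠ[𝓝 0] branchFun m b := by
  have := K.neBot ht i
  have h0 : (0 : ℂ) ∈ w.target := hw.center ▸ w.map_source hw.mem_source
  have hsymm : w.symm 0 = X.c i := by rw [← hw.center, w.left_inv hw.mem_source]
  have hp : AnalyticAt ℂ (fun s : ℂ => X.p (w.symm s)) 0 :=
    analyticAt_comp_symm X.isOpen_N X.holo_p hw.mem_atlas h0 (hsymm ▸ X.c_mem i)
  refine (hp.frequently_eq_iff_eventually_eq (analyticAt_branchFun hr hm hb)).1 ?_
  -- both sides are holomorphic at `0` and agree at the points `√2 √(u_i - λ)`, which tend to `0`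
  refine (tendsto_sheetCoord (K := K) ht i).frequently (Eventually.frequently ?_)
  filter_upwards [hP, hw.sign, (X.tendsto_sheet i).eventually (w.open_source.mem_nhds hw.mem_source),
    self_mem_nhdsWithin] with z h1 h2 h3 hz
  have h4 : w.symm (sheetCoord K t i z) = X.sheet z := by
    rw [sheetCoord, ← h2, w.left_inv h3]
  rw [h4, X.p_sheet z hz, h1]

/-- The local coordinate is obtained by inverting the branch function: `w_i` is a holomorphic
function of the local coordinate `p`. -/
theorem DubrovinCurve.exists_isLocalCoord [IsManifold 𝓘(ℂ, ℂ) 1 D]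
    (X : DubrovinCurve S t D) (ht : t ∈ C.B₀) (hr : 0 < r) (hm : ConvergesAt r m)
    (hb : ConvergesAt r b) (hm0 : m 0 ≠ 0)
    (hP : ∀ᶠ z in 𝓝[slitPlane (C.u t) K.ν] (C.u t i),
      S.P (z, t) = branchFun m b (sheetCoord K t i z)) :
    ∃ w : OpenPartialHomeomorph D ℂ, X.IsLocalCoord i w := by
  have := K.neBot ht i
  set F := 𝓝[slitPlane (C.u t) K.ν] (C.u t i) with hF
  set e := chartAt ℂ (X.c i) with he
  set y₀ := e (X.c i) with hy₀
  have hatlas : e ∈ IsManifold.maximalAtlas 𝓘(ℂ, ℂ) 1 D := IsManifold.chart_mem_maximalAtlas _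
  have hcs : X.c i ∈ e.source := mem_chart_source ℂ _
  have hy₀t : y₀ ∈ e.target := e.map_source hcs
  have hsymm : e.symm y₀ = X.c i := e.left_inv hcs
  have hpcont : ContinuousAt X.p (X.c i) :=
    (X.holo_p (X.c i) (X.c_mem i)).continuousWithinAt.continuousAt
      (X.isOpen_N.mem_nhds (X.c_mem i))
  -- `p` in the chart, with its nonvanishing derivative
  set f : ℂ → ℂ := fun y => X.p (e.symm y) with hf
  have hfan : AnalyticAt ℂ f y₀ :=
    analyticAt_comp_symm X.isOpen_N X.holo_p hatlas hy₀t (hsymm ▸ X.c_mem i)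
  have hf' : deriv f y₀ ≠ 0 := by
    intro h0
    refine X.coord_p i ?_
    have h1 : X.p =ᶠ[𝓝 (X.c i)] f ∘ e := by
      filter_upwards [e.open_source.mem_nhds hcs] with z hz
      simp only [hf, Function.comp_apply, e.left_inv hz]
    have h2 : MDifferentiableAt 𝓘(ℂ, ℂ) 𝓘(ℂ, ℂ) e (X.c i) :=
      ((contMDiffOn_of_mem_maximalAtlas hatlas).contMDiffAt
        (e.open_source.mem_nhds hcs)).mdifferentiableAt one_ne_zero
    have h4 : HasMFDerivAt 𝓘(ℂ, ℂ) 𝓘(ℂ, ℂ) f y₀ (0 : ℂ →L[ℂ] ℂ) := by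
      have h5 : HasFDerivAt f (0 : ℂ →L[ℂ] ℂ) y₀ := by
        have h6 := hfan.differentiableAt.hasDerivAt
        rw [h0] at h6
        simpa using h6.hasFDerivAt
      exact h5.hasMFDerivAt
    exact ((h4.comp (X.c i) h2.hasMFDerivAt).congr_of_eventuallyEq h1).mfderiv.trans
      (ContinuousLinearMap.zero_comp _)
  -- the inverse of the branch function
  have hQan := analyticAt_branchFun hr hm hb
  have hQ0 : deriv (branchFun m b) 0 ≠ 0 := by
    rw [(hasDerivAt_branchFun hm hb (w := 0) (by simpa using hr)).deriv, branchDeriv_zero]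
    exact hm0
  set W := hQan.hasStrictDerivAt.localInverse _ _ _ hQ0 with hW
  have hWan : AnalyticAt ℂ W (branchFun m b 0) := hQan.analyticAt_localInverse hQ0
  have hWQ : ∀ᶠ s in 𝓝 (0 : ℂ), W (branchFun m b s) = s :=
    HasStrictFDerivAt.eventually_left_inverse _
  have hW' : HasDerivAt W (deriv (branchFun m b) 0)⁻¹ (branchFun m b 0) :=
    (hQan.hasStrictDerivAt.to_localInverse hQ0).hasDerivAt
  have hcoord := tendsto_sheetCoord (K := K) ht i
  have hcoord0 : Tendsto (sheetCoord K t i) F (𝓝 0) := hcoord.mono_right nhdsWithin_le_nhds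
  have hval : X.p (X.c i) = branchFun m b 0 := by
    refine tendsto_nhds_unique (hpcont.tendsto.comp (X.tendsto_sheet i)) ?_
    refine (hQan.continuousAt.tendsto.comp hcoord0).congr' ?_
    filter_upwards [hP, self_mem_nhdsWithin] with z h1 hz
    simp only [Function.comp_apply]
    rw [X.p_sheet z hz, h1]
  have hf0 : f y₀ = branchFun m b 0 := by rw [← hval, hf]; simp only [hsymm]
  set g : ℂ → ℂ := fun y => W (f y) with hg
  have hgan : AnalyticAt ℂ g y₀ := by
    rw [← hf0] at hWan
    exact hWan.comp hfan
  have hg' : deriv g y₀ ≠ 0 := by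
    rw [← hf0] at hW'
    have h1 : HasDerivAt g _ y₀ := hW'.comp y₀ hfan.differentiableAt.hasDerivAt
    rw [h1.deriv]
    exact mul_ne_zero (inv_ne_zero hQ0) hf'
  obtain ⟨w, hwatlas, hcw, hwe, hwg⟩ := exists_localCoord_of_deriv_ne_zero (X.c i) hgan hg'
  have hsheet : ∀ᶠ z in F, X.sheet z ∈ e.source :=
    (X.tendsto_sheet i).eventually (e.open_source.mem_nhds hcs)
  have hsign : ∀ᶠ z in F, w (X.sheet z) = sheetCoord K t i z := by
    filter_upwards [hsheet, hP, hcoord0.eventually hWQ, self_mem_nhdsWithin] with z h1 h2 h3 hz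
    rw [hwg]
    change W (X.p (e.symm (e (X.sheet z)))) = _
    rw [e.left_inv h1, X.p_sheet z hz, h2, h3]
  -- `λ = u_i - w²/2` holds on the sheet, hence near `c_i`
  have hlam : AnalyticAt ℂ (fun y => X.lam (e.symm y)) y₀ :=
    analyticAt_comp_symm isOpen_univ X.holo_lam.mdifferentiableOn hatlas hy₀t (Set.mem_univ _)
  have hsq : AnalyticAt ℂ (fun y => C.u t i - g y ^ 2 / 2) y₀ := by fun_prop
  have htend : Tendsto (fun z => e (X.sheet z)) F (𝓝[≠] y₀) := by
    refine tendsto_nhdsWithin_iff.2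
      ⟨(e.continuousAt hcs).tendsto.comp (X.tendsto_sheet i), ?_⟩
    filter_upwards [hsheet, self_mem_nhdsWithin] with z h1 hz h2
    have h3 : X.sheet z = X.c i := e.injOn h1 hcs h2
    have h4 := X.lam_sheet z hz
    rw [h3, X.lam_c ht i] at h4
    exact ne_of_mem_slitPlane hz i (sub_eq_zero.2 h4)
  have hident : ∀ᶠ y in 𝓝 y₀, X.lam (e.symm y) = C.u t i - g y ^ 2 / 2 := by
    refine (hlam.frequently_eq_iff_eventually_eq hsq).1 (htend.frequently (Eventually.frequently ?_))
    filter_upwards [hsheet, hsign, self_mem_nhdsWithin] with z h1 h2 hz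
    have h3 : g (e (X.sheet z)) = sheetCoord K t i z := by rw [← h2, hwg]
    rw [e.left_inv h1, X.lam_sheet z hz, h3, sheetCoord_sq ht i hz]
    ring
  have hident' : ∀ᶠ z in 𝓝 (X.c i), X.lam z = X.lam (X.c i) - w z ^ 2 / 2 := by
    filter_upwards [(e.continuousAt hcs).eventually hident, e.open_source.mem_nhds hcs] with z h1 h2
    rw [e.left_inv h2] at h1
    rw [h1, X.lam_c ht i, hwg]
  obtain ⟨O, hO, hOo, hcO⟩ := eventually_nhds_iff.1 hident'
  have hsource : (w.restr O).source = w.source ∩ O := w.restr_source' O hOo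
  refine ⟨w.restr O, restr_mem_maximalAtlas (contDiffGroupoid 1 𝓘(ℂ, ℂ)) hwatlas hOo,
    hsource ▸ ⟨hcw, hcO⟩, ?_, fun z hz => hO z (hsource ▸ hz).2, hsign⟩
  · change w (X.c i) = 0
    rw [hwg]
    change W (f y₀) = 0
    rw [hf0]
    exact HasStrictFDerivAt.localInverse_apply_image _

end Curve

end Dubrovin

end

theorem mainTheorem3 {n : ℕ} [NeZero n] (M : Dubrovin.FrobeniusManifold n) (hd : M.d ≠ 1)
    (C : Dubrovin.CanonicalCoordinates M)
    (R : (Fin n → ℂ) → PowerSeries (Matrix (Fin n) (Fin n) ℂ)) (hR : C.IsRMatrix R)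
    (K : Dubrovin.Cuts C) (S : Dubrovin.SuperpotentialData K)
    (t : Fin n → ℂ) (ht : t ∈ C.B₀)
    {D : Type*} [TopologicalSpace D] [T2Space D] [ConnectedSpace D] [ChartedSpace ℂ D]
    [IsManifold 𝓘(ℂ, ℂ) 1 D] (X : Dubrovin.DubrovinCurve S t D) (i : Fin n) :
    X.lam (X.c i) = C.u t i ∧
    (∃ w : OpenPartialHomeomorph D ℂ, X.IsLocalCoord i w) ∧
    ∀ w : OpenPartialHomeomorph D ℂ, X.IsLocalCoord i w →
      -- the derivative of `y = p` at `c_i` in the coordinate `w`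
      HasDerivAt (fun s : ℂ => X.p (w.symm s)) (C.invSqrtΔ i t) 0 ∧
      -- the Laplace transform of `dy` along the real line of the local coordinate `w`
      (∀ᶠ ε in 𝓝[>] (0 : ℝ),
        Dubrovin.HasLaplaceExpansion (fun s : ℝ => deriv (fun z : ℂ => X.p (w.symm z)) (s : ℂ))
          (Set.Ioo (-ε) ε) (Dubrovin.invRUnitCoeff C R t i)) ∧
      -- the same over all of `ℝ`, whenever that line extends and the integral converges
      (∀ γ : ℝ → D, X.IsRealLine i w γ →
        (∃ ζ₀ : ℝ, MeasureTheory.Integrable fun s : ℝ =>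
          deriv (fun s : ℝ => X.p (γ s)) s * Complex.exp (-(ζ₀ : ℂ) * (s : ℂ) ^ 2 / 2)) →
        Dubrovin.HasLaplaceExpansion (fun s : ℝ => deriv (fun s : ℝ => X.p (γ s)) s)
          Set.univ (Dubrovin.invRUnitCoeff C R t i)) := by
  obtain ⟨r, hr, -, hm, b, hb, hP⟩ := S.exists_P_eq hd hR ht i
  set m := Dubrovin.borelCoeff C R t i with hmdef
  have hm0 : m 0 = C.invSqrtΔ i t := by
    simp [hmdef, Dubrovin.borelCoeff, Dubrovin.invRUnitCoeff, Dubrovin.coeff_zero_invSeries,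
      Dubrovin.halfRising, Matrix.one_apply]
  have hcoeff : (fun k => m k * Dubrovin.halfRising k) = Dubrovin.invRUnitCoeff C R t i := by
    funext k
    exact div_mul_cancel₀ _ (Dubrovin.halfRising_ne_zero k)
  have hP' : ∀ᶠ z in 𝓝[Dubrovin.slitPlane (C.u t) K.ν] (C.u t i),
      S.P (z, t) = Dubrovin.branchFun m b (Dubrovin.sheetCoord K t i z) := by
    filter_upwards [self_mem_nhdsWithin,
      mem_nhdsWithin_of_mem_nhds (Metric.ball_mem_nhds (C.u t i) hr)] with z hz hzr
    rw [hP z ⟨hzr, hz⟩, Dubrovin.branchFun, Dubrovin.sheetCoord_sq ht i hz, Dubrovin.sheetCoord]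
    ring
  refine ⟨X.lam_c ht i, X.exists_isLocalCoord ht hr hm hb
    (by rw [hm0]; exact C.invSqrtΔ_ne_zero ht i) hP', fun w hw => ?_⟩
  have hpw := hw.p_eventuallyEq ht hr hm hb hP'
  have hreal : Tendsto (fun s : ℝ => (s : ℂ)) (𝓝 0) (𝓝 0) := by
    simpa using Complex.continuous_ofReal.tendsto 0
  have hnear := Dubrovin.eventually_norm_sq_lt hr
  refine ⟨?_, ?_, fun γ hγ hint => ?_⟩
  · rw [← hm0, ← Dubrovin.branchDeriv_zero m b]
    exact (Dubrovin.hasDerivAt_branchFun hm hb (by simpa using hr)).congr_of_eventuallyEq hpw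
  · rw [← hcoeff]
    refine Dubrovin.eventually_hasLaplaceExpansion hr hm hb ?_
    filter_upwards [hreal.eventually hpw.eventuallyEq_nhds, hreal.eventually hnear] with s h1 h2
    rw [h1.deriv_eq, (Dubrovin.hasDerivAt_branchFun hm hb h2).deriv]
  · obtain ⟨ζ₀, hζ₀⟩ := hint
    have hγp : (fun s : ℝ => X.p (γ s)) =ᶠ[𝓝 0] fun s : ℝ => Dubrovin.branchFun m b s := by
      filter_upwards [hγ.eq_symm, hreal.eventually hpw] with s h1 h2
      rw [h1, h2]
    have hexp := Dubrovin.eventually_hasLaplaceExpansion hr hm hb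
      (g := fun s : ℝ => deriv (fun s : ℝ => X.p (γ s)) s) (by
        filter_upwards [hγp.eventuallyEq_nhds, hreal.eventually hnear] with s h1 h2
        rw [h1.deriv_eq, (Dubrovin.hasDerivAt_branchFun hm hb h2).comp_ofReal.deriv])
    obtain ⟨ε, hε, hε0⟩ := (hexp.and self_mem_nhdsWithin).exists
    rw [← hcoeff]
    exact hε.univ hε0 hζ₀
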